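/- Let $n\ge 3$, $N$ and $K\ge 1$ be natural numbers. Node $i\in\{1,\dots,n\}$ has a data distribution $\mathcal D_i$ and losses $F_i(x;\xi)$, integrable in $\xi\sim\mathcal D_i$ and differentiable in $x\in\mathbb R^N$; put $f_i(x)=\mathbb E_{\xi\sim\mathcal D_i}F_i(x;\xi)$ and $f=\frac1n\sum_{i=1}^n f_i$, and assume that $f$ is bounded below, with $f^*=\inf_x f(x)$. Assume, for constants $L\ge 0$, $\sigma>0$, $\varsigma\ge 0$, that 1. every $f_i$ is differentiable with $L$-Lipschitz gradient; 2. $\mathbb E_{\xi\sim\mathcal D_i}\|\nabla F_i(x;\xi)-\nabla f_i(x)\|^2\le\sigma^2$ for all $i$ and $x$; 3. $\frac1n\sum_{i=1}^n\|\nabla f_i(x)-\nabla f(x)\|^2\le\varsigma^2$ for all $x$. Let $W\in\mathbb R^{n\times n}$ be the weight matrix of the ring: $W_{ij}=1/3$ if $j=i$ or $j\equiv i\pm1\pmod n$, and $W_{ij}=0$ otherwise. Run D-PSGD, that is, $x_{0,i}=0$ and $$x_{k+1,i}=\sum_{j=1}^n W_{ij}x_{k,j}-\gamma\nabla F_i(x_{k,i};\xi_{k,i}),\qquad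 \gamma=\frac{1}{2L+\sigma\sqrt{K/n}},$$ with samples $\xi_{k,i}\sim\mathcal D_i$ that are independent over all $k$ and $i$, and let $\bar x_k=\frac1n\sum_{i=1}^n x_{k,i}$. Then there are constants $c>0$ and $C$, depending only on $\sigma$, $\varsigma$, $L$ and $f(0)-f^*$, such that whenever - $\varsigma=0$ (as when all nodes share the same data) and $n\le cK^{1/9}$, or - $\varsigma>0$ (data partitioned among the nodes) and $n\le cK^{1/13}$, the expectations $\mathbb E\|\nabla f(\bar x_k)\|^2$, $k<K$, are finite and $$\frac1K\sum_{k=0}^{K-1}\mathbb E\|\nabla f(\bar x_k)\|^2\;\le\;\frac{8(f(0)-f^*)L}{K}+\frac{(8f(0)-8f^*+4L)\,\sigma}{\sqrt{Kn}},$$ and, in particular (linear speedup), the left-hand side is at most $C/\sqrt{Kn}$. -/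

import Mathlib

open MeasureTheory ProbabilityTheory

noncomputable section

namespace DPSGD

/-- The parameter space `ℝ^N` with its Euclidean norm. -/
abbrev Vec (N : ℕ) := EuclideanSpace ℝ (Fin N)

/-- Weight matrix of the ring on the nodes `0, …, n - 1` (meant for `3 ≤ n`): weight `1/3` on
each node and on its two cyclic neighbours, and `0` elsewhere. -/
def ringWeights (n : ℕ) : Matrix (Fin n) (Fin n) ℝ := fun i j =>
  if j = i ∨ (j : ℕ) = ((i : ℕ) + 1) % n ∨ (i : ℕ) = ((j : ℕ) + 1) % n then 1 / 3 else 0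

variable {n N : ℕ} {Ξ Ω : Type*} [MeasurableSpace Ξ] [MeasurableSpace Ω]

/-- The local objective `f_i(x) = 𝔼_{ξ ∼ D_i} F_i(x; ξ)` of node `i`. -/
def localObj (D : Fin n → Measure Ξ) (F : Fin n → Vec N → Ξ → ℝ) (i : Fin n) (x : Vec N) : ℝ :=
  ∫ s, F i x s ∂(D i)

/-- The global objective `f(x) = (1/n) ∑ i, f_i(x)`. -/
def globalObj (D : Fin n → Measure Ξ) (F : Fin n → Vec N → Ξ → ℝ) (x : Vec N) : ℝ :=
  (1 / (n : ℝ)) * ∑ i, localObj D F i x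

/-- The stochastic gradient `∇F_i(x; s)`, the gradient being taken in `x`. -/
def stochGrad (F : Fin n → Vec N → Ξ → ℝ) (i : Fin n) (x : Vec N) (s : Ξ) : Vec N :=
  gradient (fun y => F i y s) x

/-- Standing assumptions on the local losses `F_i` and the local data distributions `D_i`.
The first five fields say that `f_i(x) = 𝔼 F_i(x; ξ)`, `∇F_i(x; ξ)` and `∇f_i(x)` make sense. -/
structure Assumptions (D : Fin n → Measure Ξ) (F : Fin n → Vec N → Ξ → ℝ) (L σ ς : ℝ) :
    Prop where
  prob : ∀ i, IsProbabilityMeasure (D i)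
  measurable : ∀ i x, Measurable (F i x)
  integrable : ∀ i x, Integrable (F i x) (D i)
  differentiable_loss : ∀ i s, Differentiable ℝ (fun x => F i x s)
  differentiable : ∀ i, Differentiable ℝ (localObj D F i)
  /-- each `f_i` has an `L`-Lipschitz gradient -/
  lipschitz : ∀ i x y,
    ‖gradient (localObj D F i) x - gradient (localObj D F i) y‖ ≤ L * ‖x - y‖
  /-- the variance of each stochastic gradient is finite and at most `σ²` -/
  variance_integrable : ∀ i x,
    Integrable (fun s => ‖stochGrad F i x s - gradient (localObj D F i) x‖ ^ 2) (D i)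
  variance_le : ∀ i x,
    ∫ s, ‖stochGrad F i x s - gradient (localObj D F i) x‖ ^ 2 ∂(D i) ≤ σ ^ 2
  /-- the variance of the local gradients over a uniformly random node is at most `ς²` -/
  diversity_le : ∀ x,
    (1 / (n : ℝ)) * ∑ i, ‖gradient (localObj D F i) x - gradient (globalObj D F) x‖ ^ 2 ≤ ς ^ 2

/-- The samples `ξ_{k,i}` are drawn independently over all iterations `k` and all nodes `i`,
with `ξ_{k,i}` distributed according to `D_i`. -/
structure IsSampling (D : Fin n → Measure Ξ) (P : Measure Ω) (ξ : ℕ → Fin n → Ω → Ξ) :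
    Prop where
  law : ∀ k i, MeasurePreserving (ξ k i) P (D i)
  indep : iIndepFun (fun p : ℕ × Fin n => ξ p.1 p.2) P

/-- The local variables `x_{k,i}` of D-PSGD with weight matrix `W` and step length `γ`:
`x_{0,i} = 0` and `x_{k+1,i} = ∑ j, W i j • x_{k,j} - γ • ∇F_i(x_{k,i}; ξ_{k,i})`. -/
def iter (W : Matrix (Fin n) (Fin n) ℝ) (γ : ℝ) (F : Fin n → Vec N → Ξ → ℝ)
    (ξ : ℕ → Fin n → Ω → Ξ) : ℕ → Fin n → Ω → Vec N
  | 0 => fun _ _ => 0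
  | k + 1 => fun i ω =>
      ∑ j, W i j • iter W γ F ξ k j ω - γ • stochGrad F i (iter W γ F ξ k i ω) (ξ k i ω)

/-- The average `(1/n) ∑ i, x_{k,i}` of the local variables. -/
def avgIter (W : Matrix (Fin n) (Fin n) ℝ) (γ : ℝ) (F : Fin n → Vec N → Ξ → ℝ)
    (ξ : ℕ → Fin n → Ω → Ξ) (k : ℕ) (ω : Ω) : Vec N :=
  (1 / (n : ℝ)) • ∑ i, iter W γ F ξ k i ω

/-- The step length `γ = 1 / (2 L + σ √(K / n))`. -/
def stepLength (L σ : ℝ) (n K : ℕ) : ℝ := 1 / (2 * L + σ * √((K : ℝ) / n))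

/-- The averaged squared gradient norm `(1/K) ∑_{k<K} 𝔼 ‖∇f((1/n) ∑ i, x_{k,i})‖²`. -/
def avgSqGrad (D : Fin n → Measure Ξ) (F : Fin n → Vec N → Ξ → ℝ)
    (W : Matrix (Fin n) (Fin n) ℝ) (γ : ℝ) (P : Measure Ω) (ξ : ℕ → Fin n → Ω → Ξ) (K : ℕ) : ℝ :=
  (∑ k ∈ Finset.range K,
    ∫ ω, ‖gradient (globalObj D F) (avgIter W γ F ξ k ω)‖ ^ 2 ∂P) / K

end DPSGD

end

/-!
With `q = 2 / (9 n²)` (a lower bound for the spectral gap of the ring), `x̄` the average of the local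
variables and `M(x) = (1/n) ∑ i, ‖x i - x̄‖²` their consensus error, the function
`V(x) = f(x̄) - f* + β M(x)` is a Lyapunov function of D-PSGD. Because the weights are doubly
stochastic, `x̄` performs a stochastic gradient step with the averaged local gradients, which are off
from `∇f(x̄)` by at most `L² M(x)` in squared norm; the descent lemma turns this into
`𝔼 f(x̄⁺) ≤ f(x̄) - (γ/2) ‖∇f(x̄)‖² + (γ/2) L² M(x) + L γ² σ² / (2 n)`, where the variance is divided
by `n` as the noises of the nodes are independent. Mixing contracts `M`, so that
`𝔼 M(x⁺) ≤ (1 - q/4) M(x) + γ² σ² + 6 ς² γ² / q` for small `γ`. With `β = 2 γ L² / q` the two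
`M`-terms cancel (`Assumptions.lintegral_lyapunov_ringStep_le`). Summation over the iterations
(`IsSampling.sum_integral_sq_gradient_le`) bounds the averaged squared gradient norm by
`2Δ/(γK) + L γ σ²/n + 18 n² L² γ² (σ² + 27 n² ς²)`. The first two terms have the required size for
the given `γ`, and the last one is dominated once `n⁷ ≲ K` (for `ς = 0`) or `n¹¹ ≲ K`, which is where
the size conditions on `n` enter.

Three points carry the argument. The spectral gap (`sum_norm_ringWeights_sq_le`) comes from
an exact identity for the mean of three vectors and a Poincaré inequality on the cycle, without
Fourier analysis. That stochastic gradients are unbiased (`Assumptions.integral_stochGrad`) is not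
assumed: along a segment, the variance bound and the fundamental theorem of calculus bound the
difference quotients of the losses in `L²`, so their means converge to the mean of the pointwise
limit. Finally, the current local variables are measurable with respect to the past samples, hence
independent of the present ones, so one may average over the present samples with the local
variables fixed; `V ≥ 0` allows all of this to be done with lower Lebesgue integrals, and the
integrability of `‖∇f(x̄_k)‖²` is a by-product of the summed inequality.
-/

noncomputable section

namespace DPSGD

/-! ### Averaging on the ring -/

section Ring

variable {n : ℕ} {E : Type*} [NormedAddCommGroup E] [InnerProductSpace ℝ E]

theorem ringWeights_sum_smul [NeZero n] (hn : 3 ≤ n) (x : Fin n → E) (i : Fin n) :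
    ∑ j, ringWeights n i j • x j = (1 / 3 : ℝ) • (x (i - 1) + x i + x (i + 1)) := by
  have h1 : ((1 : Fin n) : ℕ) = 1 := by
    rw [Fin.val_one', Nat.mod_eq_of_lt (by omega)]
  have hW : ∀ j, ringWeights n i j • x j =
      (1 / 3 : ℝ) • ((if j = i - 1 then x j else 0) + (if j = i then x j else 0) +
        (if j = i + 1 then x j else 0)) := by
    intro j
    -- For `3 ≤ n` the nodes `i - 1`, `i`, `i + 1` are distinct, so no weight is counted twice.
    have e1 : (j : ℕ) = ((i : ℕ) + 1) % n ↔ j = i + 1 := by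
      rw [Fin.ext_iff, Fin.val_add, h1]
    have e2 : (i : ℕ) = ((j : ℕ) + 1) % n ↔ j = i - 1 := by
      rw [eq_sub_iff_add_eq, Fin.ext_iff, Fin.val_add, h1, eq_comm]
    have one_ne : (1 : Fin n) ≠ 0 := by
      rw [Ne, Fin.ext_iff, h1]; simp
    have two_ne : (1 : Fin n) + 1 ≠ 0 := by
      rw [Ne, Fin.ext_iff, Fin.val_add, h1, Nat.mod_eq_of_lt (by omega)]; simp
    have d1 : i + 1 ≠ i := by simpa using one_ne
    have d2 : i - 1 ≠ i := by simpa [sub_eq_self] using one_ne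
    have d3 : i - 1 ≠ i + 1 := by
      intro h
      apply two_ne
      have := congrArg (fun t => t + 1 - i) h
      simp only [sub_add_cancel, sub_self] at this
      rw [this]; abel
    unfold ringWeights
    simp only [e1, e2]
    by_cases a : j = i
    · subst a; simp [d1.symm, d2.symm]
    by_cases b : j = i + 1
    · subst b; simp [d1, d3.symm]
    by_cases c : j = i - 1
    · subst c; simp [d2, d3]
    simp [a, b, c]
  simp_rw [hW, ← Finset.smul_sum, Finset.sum_add_distrib]
  simp

/-- The averaging step preserves the sum over the nodes. -/
theorem sum_ringWeights_sum_smul [NeZero n] (hn : 3 ≤ n) (x : Fin n → E) :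
    ∑ i, ∑ j, ringWeights n i j • x j = ∑ i, x i := by
  simp_rw [ringWeights_sum_smul hn, ← Finset.smul_sum, Finset.sum_add_distrib]
  have e1 : ∑ i, x (i - 1) = ∑ i, x i := Equiv.sum_comp (Equiv.subRight (1 : Fin n)) x
  have e2 : ∑ i, x (i + 1) = ∑ i, x i := Equiv.sum_comp (Equiv.addRight (1 : Fin n)) x
  rw [e1, e2]
  module

/-- The mean minimizes the sum of the squared distances. -/
theorem sum_norm_sub_mean_sq_le (hn : n ≠ 0) (x : Fin n → E) (z : E) :
    ∑ i, ‖x i - (1 / (n : ℝ)) • ∑ j, x j‖ ^ 2 ≤ ∑ i, ‖x i - z‖ ^ 2 := by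
  have hn' : (n : ℝ) ≠ 0 := by exact_mod_cast hn
  set m := (1 / (n : ℝ)) • ∑ j, x j with hm
  have h : ∀ i, ‖x i - z‖ ^ 2 =
      ‖x i - m‖ ^ 2 + 2 * inner ℝ (x i - m) (m - z) + ‖m - z‖ ^ 2 := by
    intro i
    rw [← norm_add_sq_real]; congr 2; abel
  have h0 : ∑ i, (x i - m) = 0 := by
    rw [Finset.sum_sub_distrib, Finset.sum_const, Finset.card_univ, Fintype.card_fin,
      ← Nat.cast_smul_eq_nsmul ℝ, hm, smul_smul, mul_one_div_cancel hn', one_smul, sub_self]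
  simp_rw [h]
  rw [Finset.sum_add_distrib, Finset.sum_add_distrib, ← Finset.mul_sum, ← sum_inner, h0,
    inner_zero_left]
  have : 0 ≤ ∑ i : Fin n, ‖m - z‖ ^ 2 := by positivity
  linarith

/-- Two values of a function on a cycle are joined by a path of at most `n` edges. -/
theorem norm_sub_zero_sq_le {E : Type*} [NormedAddCommGroup E] [NeZero n] (y : Fin n → E)
    (i : Fin n) :
    ‖y i - y 0‖ ^ 2 ≤ n * ∑ l, ‖y (l + 1) - y l‖ ^ 2 := by
  let z : ℕ → E := fun l => y (Fin.ofNat n l)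
  have hz : ∀ l : Fin n, z l = y l := fun l => by simp [z]
  have hz1 : ∀ l : Fin n, z (l + 1) = y (l + 1) := fun l => by
    simp only [z]; congr 1; ext; simp [Fin.val_add]
  have h0 : z 0 = y 0 := rfl
  have hs : ∑ l ∈ Finset.range i, (z (l + 1) - z l) = y i - y 0 := by
    rw [Finset.sum_range_sub, hz, h0]
  have hR : ∑ l, ‖y (l + 1) - y l‖ ^ 2 = ∑ l ∈ Finset.range n, ‖z (l + 1) - z l‖ ^ 2 := by
    rw [Finset.sum_range]; simp_rw [hz, hz1]
  rw [← hs, hR]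
  calc ‖∑ l ∈ Finset.range i, (z (l + 1) - z l)‖ ^ 2
      ≤ (∑ l ∈ Finset.range i, ‖z (l + 1) - z l‖) ^ 2 := by
        gcongr; exact norm_sum_le _ _
    _ ≤ (Finset.range i).card * ∑ l ∈ Finset.range i, ‖z (l + 1) - z l‖ ^ 2 :=
        sq_sum_le_card_mul_sum_sq
    _ ≤ n * ∑ l ∈ Finset.range n, ‖z (l + 1) - z l‖ ^ 2 := by
        rw [Finset.card_range]
        gcongr
        · exact i.isLt.le
        · exact i.isLt.le

/-- Poincaré inequality on the cycle. -/
theorem sum_norm_sq_le_of_sum_eq_zero [NeZero n] (y : Fin n → E) (hy : ∑ i, y i = 0) :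
    ∑ i, ‖y i‖ ^ 2 ≤ (n : ℝ) ^ 2 * ∑ l, ‖y (l + 1) - y l‖ ^ 2 := by
  have h := sum_norm_sub_mean_sq_le (NeZero.ne n) y (y 0)
  simp only [hy, smul_zero, sub_zero] at h
  refine h.trans ((Finset.sum_le_sum fun i _ => norm_sub_zero_sq_le y i).trans ?_)
  simp only [Finset.sum_const, Finset.card_univ, Fintype.card_fin, nsmul_eq_mul]
  apply le_of_eq; ring

/-- The defect in Jensen's inequality for the square of the mean of three vectors. -/
theorem norm_third_smul_sq (a b c : E) : ‖(1 / 3 : ℝ) • (a + b + c)‖ ^ 2 =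
    (‖a‖ ^ 2 + ‖b‖ ^ 2 + ‖c‖ ^ 2) / 3 - (‖b - a‖ ^ 2 + ‖c - b‖ ^ 2 + ‖c - a‖ ^ 2) / 9 := by
  rw [norm_smul, mul_pow, norm_sub_sq_real, norm_sub_sq_real, norm_sub_sq_real,
    norm_add_sq_real, norm_add_sq_real, inner_add_left, real_inner_comm a b, real_inner_comm b c,
    real_inner_comm a c]
  norm_num
  ring

/-- The spectral gap of the ring, of order `1 / n²`. -/
theorem sum_norm_ringWeights_sq_le [NeZero n] (hn : 3 ≤ n) (y : Fin n → E) (hy : ∑ i, y i = 0) :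
    ∑ i, ‖∑ j, ringWeights n i j • y j‖ ^ 2 ≤ (1 - 2 / (9 * (n : ℝ) ^ 2)) * ∑ i, ‖y i‖ ^ 2 := by
  have hn' : (0 : ℝ) < n := by exact_mod_cast (by omega : 0 < n)
  have hP := sum_norm_sq_le_of_sum_eq_zero y hy
  simp_rw [ringWeights_sum_smul hn, norm_third_smul_sq]
  have e1 : ∑ i, ‖y (i - 1)‖ ^ 2 = ∑ i, ‖y i‖ ^ 2 :=
    Equiv.sum_comp (Equiv.subRight (1 : Fin n)) fun i => ‖y i‖ ^ 2
  have e2 : ∑ i, ‖y (i + 1)‖ ^ 2 = ∑ i, ‖y i‖ ^ 2 :=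
    Equiv.sum_comp (Equiv.addRight (1 : Fin n)) fun i => ‖y i‖ ^ 2
  have e3 : ∑ i, ‖y i - y (i - 1)‖ ^ 2 = ∑ i, ‖y (i + 1) - y i‖ ^ 2 := by
    rw [← Equiv.sum_comp (Equiv.addRight (1 : Fin n)) fun i => ‖y i - y (i - 1)‖ ^ 2]
    simp
  have e4 : 0 ≤ ∑ i, ‖y (i + 1) - y (i - 1)‖ ^ 2 := by positivity
  simp_rw [Finset.sum_sub_distrib, ← Finset.sum_div, Finset.sum_add_distrib]
  rw [e1, e2, e3]
  have : 2 / (9 * (n : ℝ) ^ 2) * ∑ i, ‖y i‖ ^ 2 ≤ 2 / 9 * ∑ l, ‖y (l + 1) - y l‖ ^ 2 := by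
    calc _ ≤ 2 / (9 * (n : ℝ) ^ 2) * ((n : ℝ) ^ 2 * ∑ l, ‖y (l + 1) - y l‖ ^ 2) := by gcongr
      _ = _ := by field_simp
  linarith

end Ring

/-! ### Smoothness and measurability of the gradients -/

section

theorem hasDerivAt_comp_line {E : Type*} [NormedAddCommGroup E] [InnerProductSpace ℝ E]
    [CompleteSpace E] {f : E → ℝ} (hf : Differentiable ℝ f) (x v : E) (t : ℝ) :
    HasDerivAt (fun t : ℝ => f (x + t • v)) (inner ℝ (gradient f (x + t • v)) v) t := by
  have h1 : HasDerivAt (fun t : ℝ => x + t • v) v t := by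
    simpa using ((hasDerivAt_id t).smul_const v).const_add x
  exact (hf (x + t • v)).hasGradientAt.hasFDerivAt.comp_hasDerivAt t h1

theorem tendsto_difference_quotient {E : Type*} [NormedAddCommGroup E] [InnerProductSpace ℝ E]
    [CompleteSpace E] {f : E → ℝ} (hf : Differentiable ℝ f) (x v : E) :
    Filter.Tendsto (fun m : ℕ => ((m : ℝ) + 1) * (f (x + (1 / ((m : ℝ) + 1)) • v) - f x))
      Filter.atTop (nhds (inner ℝ (gradient f x) v)) := by
  have h1 := hasDerivAt_iff_tendsto_slope.1 (hasDerivAt_comp_line hf x v 0)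
  have h2 : Filter.Tendsto (fun m : ℕ => 1 / ((m : ℝ) + 1)) Filter.atTop (nhdsWithin 0 {0}ᶜ) :=
    tendsto_nhdsWithin_iff.2 ⟨tendsto_one_div_add_atTop_nhds_zero_nat,
      Filter.Eventually.of_forall fun m => one_div_ne_zero (Nat.cast_add_one_ne_zero m)⟩
  have h3 := h1.comp h2
  simp only [zero_smul, add_zero] at h3
  refine h3.congr fun m => ?_
  rw [Function.comp_apply, slope_def_field, zero_smul, add_zero, sub_zero, div_div_eq_mul_div,
    div_one, mul_comm]

/-- Descent lemma: a function with `L`-Lipschitz gradient lies below its quadratic model. -/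
theorem le_add_inner_add_of_lipschitz_gradient {E : Type*} [NormedAddCommGroup E]
    [InnerProductSpace ℝ E] [CompleteSpace E] {f : E → ℝ} {L : ℝ} (hf : Differentiable ℝ f)
    (hL : ∀ x y, ‖gradient f x - gradient f y‖ ≤ L * ‖x - y‖) (x v : E) :
    f (x + v) ≤ f x + inner ℝ (gradient f x) v + L / 2 * ‖v‖ ^ 2 := by
  have hd := hasDerivAt_comp_line hf x v
  have hB : ∀ t : ℝ, HasDerivAt
      (fun t : ℝ => f x + t * inner ℝ (gradient f x) v + L / 2 * ‖v‖ ^ 2 * t ^ 2)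
      (inner ℝ (gradient f x) v + L * ‖v‖ ^ 2 * t) t := by
    intro t
    have := (((hasDerivAt_id t).mul_const (inner ℝ (gradient f x) v)).const_add (f x)).add
      (((hasDerivAt_id t).pow 2).const_mul (L / 2 * ‖v‖ ^ 2))
    refine (this.congr_deriv ?_).congr_of_eventuallyEq (Filter.Eventually.of_forall fun t => ?_)
    · simp; ring
    · simp
  have key := image_le_of_deriv_right_le_deriv_boundary (a := (0 : ℝ)) (b := 1)
    (f := fun t : ℝ => f (x + t • v))
    (B := fun t : ℝ => f x + t * inner ℝ (gradient f x) v + L / 2 * ‖v‖ ^ 2 * t ^ 2)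
    (fun t _ => (hd t).continuousAt.continuousWithinAt) (fun t _ => (hd t).hasDerivWithinAt)
    (by simp) (fun t _ => (hB t).continuousAt.continuousWithinAt)
    (fun t _ => (hB t).hasDerivWithinAt)
    (fun t ht => by
      have h3 : inner ℝ (gradient f (x + t • v) - gradient f x) v ≤ L * ‖v‖ ^ 2 * t := by
        calc _ ≤ ‖gradient f (x + t • v) - gradient f x‖ * ‖v‖ := real_inner_le_norm _ _
          _ ≤ (L * ‖x + t • v - x‖) * ‖v‖ := by gcongr; exact hL _ _
          _ = L * ‖v‖ ^ 2 * t := by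
            rw [add_sub_cancel_left, norm_smul, Real.norm_of_nonneg ht.1]; ring
      rw [inner_sub_left] at h3
      linarith)
    (Set.right_mem_Icc.2 zero_le_one)
  simpa using key

variable {n N : ℕ} {Ξ : Type*} [MeasurableSpace Ξ] {D : Fin n → Measure Ξ}
  {F : Fin n → Vec N → Ξ → ℝ} {L σ ς : ℝ}

namespace Assumptions

theorem hasGradientAt_globalObj (h : Assumptions D F L σ ς) (x : Vec N) :
    HasGradientAt (globalObj D F) ((1 / (n : ℝ)) • ∑ i, gradient (localObj D F i) x) x := by
  have h1 : HasFDerivAt (fun x => ∑ i, localObj D F i x)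
      (∑ i, InnerProductSpace.toDual ℝ (Vec N) (gradient (localObj D F i) x)) x :=
    HasFDerivAt.fun_sum fun i _ => (h.differentiable i x).hasGradientAt.hasFDerivAt
  have h2 := h1.const_mul (1 / (n : ℝ))
  rw [hasGradientAt_iff_hasFDerivAt]
  rw [map_smul, map_sum]
  exact h2

theorem gradient_globalObj (h : Assumptions D F L σ ς) (x : Vec N) :
    gradient (globalObj D F) x = (1 / (n : ℝ)) • ∑ i, gradient (localObj D F i) x :=
  (h.hasGradientAt_globalObj x).gradient

theorem differentiable_globalObj (h : Assumptions D F L σ ς) :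
    Differentiable ℝ (globalObj D F) :=
  fun x => (h.hasGradientAt_globalObj x).differentiableAt

theorem lipschitz_globalObj (h : Assumptions D F L σ ς) (hn : n ≠ 0) (x y : Vec N) :
    ‖gradient (globalObj D F) x - gradient (globalObj D F) y‖ ≤ L * ‖x - y‖ := by
  have hn' : (0 : ℝ) < n := by exact_mod_cast Nat.pos_of_ne_zero hn
  rw [h.gradient_globalObj, h.gradient_globalObj, ← smul_sub, ← Finset.sum_sub_distrib, norm_smul,
    Real.norm_of_nonneg (by positivity)]
  calc _ ≤ 1 / (n : ℝ) * ∑ i : Fin n, L * ‖x - y‖ := by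
        gcongr
        exact (norm_sum_le _ _).trans (Finset.sum_le_sum fun i _ => h.lipschitz i x y)
    _ = L * ‖x - y‖ := by
        simp only [Finset.sum_const, Finset.card_univ, Fintype.card_fin, nsmul_eq_mul]
        field_simp

theorem continuous_gradient_localObj (h : Assumptions D F L σ ς) (i : Fin n) :
    Continuous (gradient (localObj D F i)) := by
  refine (LipschitzWith.of_dist_le_mul (K := L.toNNReal) fun x y => ?_).continuous
  rw [dist_eq_norm, dist_eq_norm]
  exact (h.lipschitz i x y).trans (by gcongr; exact Real.le_coe_toNNReal L)

theorem continuous_gradient_globalObj (h : Assumptions D F L σ ς) :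
    Continuous (gradient (globalObj D F)) := by
  rw [funext h.gradient_globalObj]
  have := h.continuous_gradient_localObj
  fun_prop

theorem measurable_uncurry_loss (h : Assumptions D F L σ ς) (i : Fin n) :
    Measurable (Function.uncurry (F i)) :=
  measurable_uncurry_of_continuous_of_measurable
    (fun s => (h.differentiable_loss i s).continuous) (h.measurable i)

theorem hasDerivAt_loss_line (h : Assumptions D F L σ ς) (i : Fin n) (x v : Vec N) (s : Ξ)
    (t : ℝ) :
    HasDerivAt (fun t : ℝ => F i (x + t • v) s) (inner ℝ (stochGrad F i (x + t • v) s) v) t := 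
  hasDerivAt_comp_line (h.differentiable_loss i s) x v t

theorem measurable_uncurry_stochGrad (h : Assumptions D F L σ ς) (i : Fin n) :
    Measurable (Function.uncurry (stochGrad F i)) := by
  have hF := h.measurable_uncurry_loss i
  have h1 : ∀ v : Vec N, Measurable fun p : Vec N × Ξ => inner ℝ (stochGrad F i p.1 p.2) v := by
    intro v
    refine measurable_of_tendsto_metrizable (f := fun (m : ℕ) (p : Vec N × Ξ) =>
      ((m : ℝ) + 1) * (F i (p.1 + (1 / ((m : ℝ) + 1)) • v) p.2 - F i p.1 p.2)) (fun m => ?_)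
      (tendsto_pi_nhds.2 fun p => 
        tendsto_difference_quotient (h.differentiable_loss i p.2) p.1 v)
    have e1 : Measurable fun p : Vec N × Ξ => F i (p.1 + (1 / ((m : ℝ) + 1)) • v) p.2 :=
      hF.comp (f := fun p : Vec N × Ξ => (p.1 + (1 / ((m : ℝ) + 1)) • v, p.2))
        ((measurable_fst.add_const _).prodMk measurable_snd)
    have e2 : Measurable fun p : Vec N × Ξ => F i p.1 p.2 := hF
    exact (e1.sub e2).const_mul _
  have h2 : Function.uncurry (stochGrad F i) = fun p : Vec N × Ξ => ∑ j,
      (inner ℝ (stochGrad F i p.1 p.2) (EuclideanSpace.basisFun (Fin N) ℝ j)) •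
        EuclideanSpace.basisFun (Fin N) ℝ j := by
    funext p
    refine ((EuclideanSpace.basisFun (Fin N) ℝ).sum_repr' _).symm.trans ?_
    exact Finset.sum_congr rfl fun j _ => by rw [real_inner_comm]; rfl
  rw [h2]
  exact Finset.measurable_sum _ fun j _ => (h1 _).smul_const _

theorem measurable_stochGrad (h : Assumptions D F L σ ς) (i : Fin n) (x : Vec N) :
    Measurable (stochGrad F i x) :=
  (h.measurable_uncurry_stochGrad i).comp measurable_prodMk_left

end Assumptions

end

/-! ### Unbiasedness of the stochastic gradients -/

section

theorem sq_integral_le_integral_sq {Ω : Type*} [MeasurableSpace Ω] {μ : Measure Ω}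
    [IsProbabilityMeasure μ] {f : Ω → ℝ} (hf : MemLp f 2 μ) :
    (∫ ω, f ω ∂μ) ^ 2 ≤ ∫ ω, f ω ^ 2 ∂μ := by
  have h1 := variance_eq_sub hf
  have h2 := variance_nonneg f μ
  simp only [Pi.pow_apply] at h1
  linarith

/-- The increment of an everywhere differentiable function is controlled by the `L²` norm of its
derivative, which may be infinite. -/
theorem ofReal_sq_sub_le_lintegral {φ φ' : ℝ → ℝ} (hφ : ∀ t, HasDerivAt φ (φ' t) t)
    (hm : Measurable φ') :
    ENNReal.ofReal ((φ 1 - φ 0) ^ 2) ≤ ∫⁻ t in Set.Ioc 0 1, ENNReal.ofReal (φ' t ^ 2) := by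
  by_cases hfin : ∫⁻ t in Set.Ioc (0 : ℝ) 1, ENNReal.ofReal (φ' t ^ 2) = ⊤
  · simp [hfin]
  have : IsProbabilityMeasure (volume.restrict (Set.Ioc (0 : ℝ) 1)) := ⟨by simp⟩
  have hsq : Integrable (fun t => φ' t ^ 2) (volume.restrict (Set.Ioc (0 : ℝ) 1)) :=
    (lintegral_ofReal_ne_top_iff_integrable (hm.pow_const 2).aestronglyMeasurable
      (Filter.Eventually.of_forall fun t => sq_nonneg _)).1 hfin
  have hL : MemLp φ' 2 (volume.restrict (Set.Ioc (0 : ℝ) 1)) :=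
    (memLp_two_iff_integrable_sq hm.aestronglyMeasurable).2 hsq
  have hI : IntervalIntegrable φ' volume 0 1 :=
    (intervalIntegrable_iff_integrableOn_Ioc_of_le zero_le_one).2 (hL.integrable one_le_two)
  rw [← intervalIntegral.integral_eq_sub_of_hasDerivAt (fun t _ => hφ t) hI,
    intervalIntegral.integral_of_le zero_le_one,
    ← ofReal_integral_eq_lintegral_ofReal hsq (Filter.Eventually.of_forall fun t => sq_nonneg _)]
  exact ENNReal.ofReal_le_ofReal (sq_integral_le_integral_sq hL)

/-- Pointwise convergence together with an `L²` bound implies convergence of the means. -/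
theorem tendsto_integral_zero_of_sq_le {Ω : Type*} [MeasurableSpace Ω] {μ : Measure Ω}
    [IsFiniteMeasure μ] {u : ℕ → Ω → ℝ} {C : ℝ} (hu : ∀ m, MemLp (u m) 2 μ)
    (hC : ∀ m, ∫ ω, u m ω ^ 2 ∂μ ≤ C)
    (h0 : ∀ ω, Filter.Tendsto (fun m => u m ω) Filter.atTop (nhds 0)) :
    Filter.Tendsto (fun m => ∫ ω, u m ω ∂μ) Filter.atTop (nhds 0) := by
  have hC0 : 0 ≤ C := (integral_nonneg fun ω => sq_nonneg (u 0 ω)).trans (hC 0)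
  rw [Metric.tendsto_atTop']
  intro ε hε
  -- The part of `u m` above the level `R` has mean at most `C / R`.
  set R : ℝ := (2 * C + 1) / ε with hR
  have hRpos : 0 < R := by positivity
  have hCR : C / R < ε / 2 := by
    rw [hR, div_div_eq_mul_div, div_lt_div_iff₀ (by positivity) (by norm_num)]
    nlinarith
  have hint : ∀ m, Integrable (fun ω => min |u m ω| R) μ := fun m =>
    Integrable.mono' (integrable_const R)
      ((hu m).1.norm.inf aestronglyMeasurable_const)
      (Filter.Eventually.of_forall fun ω => by
        rw [Real.norm_of_nonneg (le_min (abs_nonneg _) hRpos.le)]; exact min_le_right _ _)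
  have hD : Filter.Tendsto (fun m => ∫ ω, min |u m ω| R ∂μ) Filter.atTop (nhds (∫ _, (0 : ℝ) ∂μ)) := by
    refine tendsto_integral_of_dominated_convergence (fun _ => R) (fun m => (hint m).1)
      (integrable_const R) (fun m => Filter.Eventually.of_forall fun ω => ?_)
      (Filter.Eventually.of_forall fun ω => ?_)
    · rw [Real.norm_of_nonneg (le_min (abs_nonneg _) hRpos.le)]; exact min_le_right _ _
    · have := ((h0 ω).abs).min (tendsto_const_nhds (x := R))
      simpa [hRpos.le] using this
  rw [integral_zero] at hD
  obtain ⟨M, hM⟩ := (Metric.tendsto_atTop'.1 hD) (ε / 2) (by positivity)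
  refine ⟨M, fun m hm => ?_⟩
  have h1 := hM m hm
  rw [Real.dist_eq, sub_zero] at h1 ⊢
  have h2 : ∫ ω, |u m ω| ∂μ ≤ ∫ ω, (min |u m ω| R + u m ω ^ 2 / R) ∂μ := by
    refine integral_mono ((hu m).integrable one_le_two).abs
      ((hint m).add ((hu m).integrable_sq.div_const R)) fun ω => ?_
    rcases le_total |u m ω| R with h | h
    · have : 0 ≤ u m ω ^ 2 / R := by positivity
      simp only [min_eq_left h]; linarith
    · simp only [min_eq_right h]
      have : |u m ω| ≤ u m ω ^ 2 / R := by
        rw [le_div_iff₀ hRpos, ← sq_abs]; nlinarith [abs_nonneg (u m ω)]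
      linarith
  rw [integral_add (hint m) ((hu m).integrable_sq.div_const R), integral_div] at h2
  have h3 : (∫ ω, u m ω ^ 2 ∂μ) / R ≤ C / R := by gcongr; exact hC m
  calc |∫ ω, u m ω ∂μ| ≤ ∫ ω, |u m ω| ∂μ := abs_integral_le_integral_abs
    _ < ε := by linarith [le_abs_self (∫ ω, min |u m ω| R ∂μ)]

variable {n N : ℕ} {Ξ : Type*} [MeasurableSpace Ξ] {D : Fin n → Measure Ξ}
  {F : Fin n → Vec N → Ξ → ℝ} {L σ ς : ℝ}

namespace Assumptions

theorem memLp_stochGrad_sub (h : Assumptions D F L σ ς) (i : Fin n) (x : Vec N) :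
    MemLp (fun s => stochGrad F i x s - gradient (localObj D F i) x) 2 (D i) :=
  (memLp_two_iff_integrable_sq_norm
    ((h.measurable_stochGrad i x).sub_const _).aestronglyMeasurable).2 (h.variance_integrable i x)

theorem memLp_stochGrad (h : Assumptions D F L σ ς) (i : Fin n) (x : Vec N) :
    MemLp (stochGrad F i x) 2 (D i) := by
  have := h.prob i
  have h1 := (h.memLp_stochGrad_sub i x).add (memLp_const (gradient (localObj D F i) x))
  exact h1.congr_norm (h.measurable_stochGrad i x).aestronglyMeasurable
    (Filter.Eventually.of_forall fun s => by simp)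

/-- Local uniform second moment bound for the directional derivatives of the loss. -/
theorem integral_sq_inner_stochGrad_le (h : Assumptions D F L σ ς) (i : Fin n) (x w v : Vec N)
    (hw : ‖w‖ ≤ ‖v‖) (hL : 0 ≤ L) :
    ∫ s, inner ℝ (stochGrad F i (x + w) s) v ^ 2 ∂(D i) ≤
      2 * ‖v‖ ^ 2 * (σ ^ 2 + (‖gradient (localObj D F i) x‖ + L * ‖v‖) ^ 2) := by
  have := h.prob i
  set a := gradient (localObj D F i) (x + w)
  have ha : ‖a‖ ≤ ‖gradient (localObj D F i) x‖ + L * ‖v‖ := by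
    have h1 := h.lipschitz i (x + w) x
    rw [add_sub_cancel_left] at h1
    have h2 : L * ‖w‖ ≤ L * ‖v‖ := by gcongr
    have h3 := norm_le_norm_add_norm_sub' a (gradient (localObj D F i) x)
    linarith
  have hv := h.variance_integrable i (x + w)
  calc ∫ s, inner ℝ (stochGrad F i (x + w) s) v ^ 2 ∂(D i)
      ≤ ∫ s, 2 * ‖v‖ ^ 2 * (‖stochGrad F i (x + w) s - a‖ ^ 2 + ‖a‖ ^ 2) ∂(D i) := by
        refine integral_mono ((h.memLp_stochGrad i (x + w)).inner_const v).integrable_sq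
          ((hv.add (integrable_const _)).const_mul _) fun s => ?_
        have h1 : |inner ℝ (stochGrad F i (x + w) s) v| ≤ ‖stochGrad F i (x + w) s‖ * ‖v‖ :=
          abs_real_inner_le_norm _ _
        have h2 : ‖stochGrad F i (x + w) s‖ ≤ ‖stochGrad F i (x + w) s - a‖ + ‖a‖ := by
          have := norm_add_le (stochGrad F i (x + w) s - a) a
          rwa [sub_add_cancel] at this
        calc inner ℝ (stochGrad F i (x + w) s) v ^ 2
            ≤ ((‖stochGrad F i (x + w) s - a‖ + ‖a‖) * ‖v‖) ^ 2 := by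
              rw [← sq_abs]; gcongr; exact h1.trans (by gcongr)
          _ ≤ _ := by
              rw [mul_pow]
              nlinarith [mul_nonneg (sq_nonneg ‖v‖)
                (sq_nonneg (‖stochGrad F i (x + w) s - a‖ - ‖a‖))]
    _ = 2 * ‖v‖ ^ 2 * (∫ s, ‖stochGrad F i (x + w) s - a‖ ^ 2 ∂(D i) + ‖a‖ ^ 2) := by
        rw [integral_const_mul, integral_add hv (integrable_const _), integral_const,
          probReal_univ, one_smul]
    _ ≤ _ := by
        gcongr
        exact h.variance_le i (x + w)

/-- The difference quotients of the loss are bounded in `L²`. -/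
theorem lintegral_sq_quotient_le (h : Assumptions D F L σ ς) (hL : 0 ≤ L) (i : Fin n)
    (x v : Vec N) (m : ℕ) :
    ∫⁻ s, ENNReal.ofReal
      ((((m : ℝ) + 1) * (F i (x + (1 / ((m : ℝ) + 1)) • v) s - F i x s)) ^ 2) ∂(D i) ≤
      ENNReal.ofReal (2 * ‖v‖ ^ 2 * (σ ^ 2 + (‖gradient (localObj D F i) x‖ + L * ‖v‖) ^ 2)) := by
  have := h.prob i
  have hm : (0 : ℝ) < (m : ℝ) + 1 := by positivity
  have hmeas : Measurable (Function.uncurry fun (s : Ξ) (t : ℝ) =>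
      inner ℝ (stochGrad F i (x + t • (1 / ((m : ℝ) + 1)) • v) s) v) := by
    refine Measurable.inner ?_ measurable_const
    exact (h.measurable_uncurry_stochGrad i).comp
      (f := fun p : Ξ × ℝ => (x + p.2 • (1 / ((m : ℝ) + 1)) • v, p.1))
      (((measurable_snd.smul_const _).const_add x).prodMk measurable_fst)
  calc _ ≤ ∫⁻ s, (∫⁻ t in Set.Ioc (0 : ℝ) 1, ENNReal.ofReal
        (inner ℝ (stochGrad F i (x + t • (1 / ((m : ℝ) + 1)) • v) s) v ^ 2)) ∂(D i) := by
        refine lintegral_mono fun s => ?_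
        have h1 := ofReal_sq_sub_le_lintegral
          (φ := fun t => ((m : ℝ) + 1) * F i (x + t • (1 / ((m : ℝ) + 1)) • v) s)
          (φ' := fun t => inner ℝ (stochGrad F i (x + t • (1 / ((m : ℝ) + 1)) • v) s) v)
          (fun t => by
            refine ((h.hasDerivAt_loss_line i x ((1 / ((m : ℝ) + 1)) • v) s t).const_mul
              ((m : ℝ) + 1)).congr_deriv ?_
            rw [real_inner_smul_right, ← mul_assoc, mul_one_div_cancel hm.ne', one_mul])
          (hmeas.of_uncurry_left (x := s))
        rw [one_smul, zero_smul, add_zero, ← mul_sub] at h1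
        exact h1
    _ = ∫⁻ t in Set.Ioc (0 : ℝ) 1, ∫⁻ s, ENNReal.ofReal
        (inner ℝ (stochGrad F i (x + t • (1 / ((m : ℝ) + 1)) • v) s) v ^ 2) ∂(D i) :=
        lintegral_lintegral_swap (hmeas.pow_const 2).ennreal_ofReal.aemeasurable
    _ ≤ ∫⁻ t in Set.Ioc (0 : ℝ) 1, ENNReal.ofReal
        (2 * ‖v‖ ^ 2 * (σ ^ 2 + (‖gradient (localObj D F i) x‖ + L * ‖v‖) ^ 2)) := by
        refine setLIntegral_mono measurable_const fun t ht => ?_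
        rw [← ofReal_integral_eq_lintegral_ofReal
          ((h.memLp_stochGrad i _).inner_const v).integrable_sq
          (Filter.Eventually.of_forall fun s => sq_nonneg _)]
        refine ENNReal.ofReal_le_ofReal (h.integral_sq_inner_stochGrad_le i x _ v ?_ hL)
        rw [smul_smul, norm_smul, Real.norm_of_nonneg (mul_nonneg ht.1.le (by positivity))]
        refine mul_le_of_le_one_left (norm_nonneg v) (mul_le_one₀ ht.2 (by positivity) ?_)
        rw [div_le_one hm]; simp
    _ = _ := by simp

/-- The stochastic gradients are unbiased: the difference quotients of the loss converge
pointwise and are bounded in `L²`, so differentiation and expectation commute. -/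
theorem integral_stochGrad (h : Assumptions D F L σ ς) (hL : 0 ≤ L) (i : Fin n) (x : Vec N) :
    ∫ s, stochGrad F i x s ∂(D i) = gradient (localObj D F i) x := by
  have := h.prob i
  have hGint := (h.memLp_stochGrad i x).integrable one_le_two
  refine ext_inner_right ℝ fun v => ?_
  have e1 : inner ℝ (∫ s, stochGrad F i x s ∂(D i)) v =
      ∫ s, inner ℝ (stochGrad F i x s) v ∂(D i) := by
    rw [real_inner_comm, ← integral_inner hGint]
    exact integral_congr_ae (Filter.Eventually.of_forall fun s => real_inner_comm _ _)
  rw [e1]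
  set C := 2 * ‖v‖ ^ 2 * (σ ^ 2 + (‖gradient (localObj D F i) x‖ + L * ‖v‖) ^ 2) with hC
  have hC0 : 0 ≤ C := by positivity
  set g : Ξ → ℝ := fun s => inner ℝ (stochGrad F i x s) v
  set q : ℕ → Ξ → ℝ := fun m s =>
    ((m : ℝ) + 1) * (F i (x + (1 / ((m : ℝ) + 1)) • v) s - F i x s) with hq
  have hg : MemLp g 2 (D i) := (h.memLp_stochGrad i x).inner_const v
  have hgC : ∫ s, g s ^ 2 ∂(D i) ≤ C := by
    have := h.integral_sq_inner_stochGrad_le i x 0 v (by simp) hL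
    simpa using this
  have hqm : ∀ m, Measurable (q m) := fun m =>
    ((h.measurable i _).sub (h.measurable i _)).const_mul _
  have hqi : ∀ m, Integrable (q m) (D i) := fun m =>
    ((h.integrable i _).sub (h.integrable i _)).const_mul _
  have hqsq : ∀ m, Integrable (fun s => q m s ^ 2) (D i) := fun m =>
    (lintegral_ofReal_ne_top_iff_integrable ((hqm m).pow_const 2).aestronglyMeasurable
      (Filter.Eventually.of_forall fun t => sq_nonneg _)).1
      ((h.lintegral_sq_quotient_le hL i x v m).trans_lt ENNReal.ofReal_lt_top).ne
  have hqL : ∀ m, MemLp (q m) 2 (D i) := fun m =>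
    (memLp_two_iff_integrable_sq (hqm m).aestronglyMeasurable).2 (hqsq m)
  have hqC : ∀ m, ∫ s, q m s ^ 2 ∂(D i) ≤ C := fun m => by
    rw [← ENNReal.ofReal_le_ofReal_iff hC0, ofReal_integral_eq_lintegral_ofReal (hqsq m)
      (Filter.Eventually.of_forall fun t => sq_nonneg _)]
    exact h.lintegral_sq_quotient_le hL i x v m
  have hlim := tendsto_integral_zero_of_sq_le (μ := D i) (u := fun m s => q m s - g s)
    (C := 4 * C) (fun m => (hqL m).sub hg)
    (fun m => by
      calc ∫ s, (q m s - g s) ^ 2 ∂(D i) ≤ ∫ s, (2 * q m s ^ 2 + 2 * g s ^ 2) ∂(D i) := by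
            refine integral_mono ((hqL m).sub hg).integrable_sq
              (((hqsq m).const_mul 2).add (hg.integrable_sq.const_mul 2)) fun s => ?_
            simp only
            nlinarith [sq_nonneg (q m s + g s)]
        _ = 2 * ∫ s, q m s ^ 2 ∂(D i) + 2 * ∫ s, g s ^ 2 ∂(D i) := by
            rw [integral_add ((hqsq m).const_mul 2) (hg.integrable_sq.const_mul 2),
              integral_const_mul, integral_const_mul]
        _ ≤ 4 * C := by linarith [hqC m])
    (fun s => by
      have := (tendsto_difference_quotient (h.differentiable_loss i s) x v).sub_const (g s)
      rwa [show inner ℝ (gradient (fun y => F i y s) x) v - g s = 0 from sub_self _] at this)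
  have e2 : ∀ m, ∫ s, (q m s - g s) ∂(D i) =
      ((m : ℝ) + 1) * (localObj D F i (x + (1 / ((m : ℝ) + 1)) • v) - localObj D F i x) -
        ∫ s, g s ∂(D i) := fun m => by
    rw [integral_sub (hqi m) (hg.integrable one_le_two), hq, integral_const_mul,
      integral_sub (h.integrable i _) (h.integrable i _)]
    rfl
  simp_rw [e2] at hlim
  have hlim' := (tendsto_difference_quotient (h.differentiable i) x v).sub_const
    (∫ s, g s ∂(D i))
  exact (sub_eq_zero.1 (tendsto_nhds_unique hlim' hlim)).symm

end Assumptions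

end

/-! ### Expected decrease of the Lyapunov function in one iteration -/

section

/-- The second moment of an affine combination of independent centred vectors. -/
theorem integral_norm_add_smul_sum_sq {Ω E ι : Type*} [Fintype ι] [MeasurableSpace Ω]
    {μ : Measure Ω} [IsProbabilityMeasure μ] [NormedAddCommGroup E] [InnerProductSpace ℝ E]
    [CompleteSpace E] [MeasurableSpace E] [BorelSpace E] {ζ : ι → Ω → E}
    (hζ : ∀ i, MemLp (ζ i) 2 μ) (h0 : ∀ i, ∫ ω, ζ i ω ∂μ = 0)
    (hind : Pairwise fun i j => IndepFun (ζ i) (ζ j) μ) (a : E) (c : ℝ) :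
    ∫ ω, ‖a + c • ∑ i, ζ i ω‖ ^ 2 ∂μ = ‖a‖ ^ 2 + c ^ 2 * ∑ i, ∫ ω, ‖ζ i ω‖ ^ 2 ∂μ := by
  classical
  have hint : ∀ i, Integrable (ζ i) μ := fun i => (hζ i).integrable one_le_two
  have hexp : ∀ ω, ‖a + c • ∑ i, ζ i ω‖ ^ 2 =
      ‖a‖ ^ 2 + 2 * c * ∑ i, inner ℝ a (ζ i ω) + c ^ 2 * ∑ i, ∑ j, inner ℝ (ζ i ω) (ζ j ω) := by
    intro ω
    rw [norm_add_sq_real, norm_smul, mul_pow, Real.norm_eq_abs, sq_abs, real_inner_smul_right,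
      inner_sum, ← real_inner_self_eq_norm_sq (∑ i, ζ i ω), sum_inner]
    simp_rw [inner_sum]
    ring
  have i1 : ∀ i, Integrable (fun ω => inner ℝ a (ζ i ω)) μ := fun i => (hint i).const_inner a
  have i2 : ∀ i j, Integrable (fun ω => inner ℝ (ζ i ω) (ζ j ω)) μ := fun i j =>
    (((hζ i).norm.integrable_mul (hζ j).norm).mono' ((hζ i).1.inner (hζ j).1)
      (Filter.Eventually.of_forall fun ω => norm_inner_le_norm _ _))
  have e1 : ∀ i, ∫ ω, inner ℝ a (ζ i ω) ∂μ = 0 := fun i => by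
    rw [integral_inner (hint i), h0, inner_zero_right]
  have e2 : ∀ i j, ∫ ω, inner ℝ (ζ i ω) (ζ j ω) ∂μ =
      if i = j then ∫ ω, ‖ζ i ω‖ ^ 2 ∂μ else 0 := by
    intro i j
    split_ifs with hij
    · subst hij; simp_rw [real_inner_self_eq_norm_sq]
    · have := (hind hij).integral_bilin (hint i) (hint j) (innerSL ℝ)
      rw [h0, h0, map_zero] at this
      exact this
  simp_rw [hexp]
  rw [integral_add, integral_add, integral_const_mul, integral_const_mul, integral_finsetSum,
    integral_finsetSum]
  · simp_rw [e1]
    have e3 : ∀ i, ∫ ω, ∑ j, inner ℝ (ζ i ω) (ζ j ω) ∂μ = ∫ ω, ‖ζ i ω‖ ^ 2 ∂μ := fun i => by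
      rw [integral_finsetSum _ fun j _ => i2 i j]
      simp [e2]
    simp [e3]
  · exact fun i _ => integrable_finsetSum _ fun j _ => i2 i j
  · exact fun i _ => i1 i
  · exact integrable_const _
  · exact (integrable_finsetSum _ fun i _ => i1 i).const_mul _
  · exact (integrable_const _).add ((integrable_finsetSum _ fun i _ => i1 i).const_mul _)
  · exact (integrable_finsetSum _ fun i _ => integrable_finsetSum _ fun j _ => i2 i j).const_mul _

/-- The mean of the quadratic upper model of the Lyapunov function after one iteration, for
noise vectors `ζ i` that are independent, centred and of variance at most `σ²`. -/
theorem integral_quadratic_model_le {Ω E : Type*} {n : ℕ} (hn : n ≠ 0) [MeasurableSpace Ω]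
    {μ : Measure Ω} [IsProbabilityMeasure μ] [NormedAddCommGroup E] [InnerProductSpace ℝ E]
    [CompleteSpace E] [MeasurableSpace E] [BorelSpace E] {ζ : Fin n → Ω → E}
    (hζ : ∀ i, MemLp (ζ i) 2 μ) (h0 : ∀ i, ∫ ω, ζ i ω ∂μ = 0)
    (hind : Pairwise fun i j => IndepFun (ζ i) (ζ j) μ) {σ L β : ℝ}
    (hσ : ∀ i, ∫ ω, ‖ζ i ω‖ ^ 2 ∂μ ≤ σ ^ 2) (hL : 0 ≤ L) (hβ : 0 ≤ β) (κ γ : ℝ) (p g : E)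
    (a : Fin n → E) :
    Integrable (fun ω => κ + inner ℝ p (-(γ • g) + (-(γ / n)) • ∑ i, ζ i ω) +
      L / 2 * ‖-(γ • g) + (-(γ / n)) • ∑ i, ζ i ω‖ ^ 2 +
      β * ((1 / (n : ℝ)) * ∑ i, ‖a i + (-γ) • ζ i ω‖ ^ 2)) μ ∧
    ∫ ω, (κ + inner ℝ p (-(γ • g) + (-(γ / n)) • ∑ i, ζ i ω) +
      L / 2 * ‖-(γ • g) + (-(γ / n)) • ∑ i, ζ i ω‖ ^ 2 +
      β * ((1 / (n : ℝ)) * ∑ i, ‖a i + (-γ) • ζ i ω‖ ^ 2)) ∂μ ≤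
    κ - γ * inner ℝ p g + L / 2 * (γ ^ 2 * ‖g‖ ^ 2 + γ ^ 2 * σ ^ 2 / n) +
      β * ((1 / (n : ℝ)) * ∑ i, ‖a i‖ ^ 2 + γ ^ 2 * σ ^ 2) := by
  have hn' : (0 : ℝ) < n := by exact_mod_cast Nat.pos_of_ne_zero hn
  have hζi : ∀ i, Integrable (ζ i) μ := fun i => (hζ i).integrable one_le_two
  let v : Ω → E := fun ω => -(γ • g) + (-(γ / n)) • ∑ i, ζ i ω
  have hvL : MemLp v 2 μ :=
    (memLp_const (-(γ • g))).add
      ((memLp_finsetSum Finset.univ fun i _ => hζ i).const_smul (-(γ / (n : ℝ))))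
  have iv1 : Integrable (fun ω => inner ℝ p (v ω)) μ := (hvL.integrable one_le_two).const_inner p
  have iv2 : Integrable (fun ω => L / 2 * ‖v ω‖ ^ 2) μ :=
    (hvL.integrable_norm_pow two_ne_zero).const_mul _
  have ia : ∀ i, Integrable (fun ω => ‖a i + (-γ) • ζ i ω‖ ^ 2) μ := fun i =>
    ((memLp_const (a i)).add ((hζ i).const_smul (-γ))).integrable_norm_pow two_ne_zero
  have ev1 : ∫ ω, inner ℝ p (v ω) ∂μ = -(γ * inner ℝ p g) := by
    have : ∫ ω, v ω ∂μ = -(γ • g) := by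
      simp only [v]
      have hs : Integrable (fun ω => (-(γ / (n : ℝ))) • ∑ i, ζ i ω) μ :=
        (integrable_finsetSum Finset.univ fun i _ => hζi i).smul (-(γ / (n : ℝ)))
      rw [integral_add (integrable_const _) hs,
        integral_const, probReal_univ, one_smul, integral_smul,
        integral_finsetSum _ fun i _ => hζi i]
      simp [h0]
    rw [integral_inner (hvL.integrable one_le_two), this, inner_neg_right, real_inner_smul_right]
  have ev2 : ∫ ω, ‖v ω‖ ^ 2 ∂μ ≤ γ ^ 2 * ‖g‖ ^ 2 + γ ^ 2 * σ ^ 2 / n := by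
    rw [integral_norm_add_smul_sum_sq hζ h0 hind, norm_neg, norm_smul, mul_pow, Real.norm_eq_abs,
      sq_abs]
    have : ∑ i, ∫ ω, ‖ζ i ω‖ ^ 2 ∂μ ≤ n * σ ^ 2 := by
      simpa using Finset.sum_le_sum fun i (_ : i ∈ Finset.univ) => hσ i
    calc _ ≤ γ ^ 2 * ‖g‖ ^ 2 + (-(γ / n)) ^ 2 * (n * σ ^ 2) := by gcongr
      _ = _ := by field_simp
  have ea : ∀ i, ∫ ω, ‖a i + (-γ) • ζ i ω‖ ^ 2 ∂μ ≤ ‖a i‖ ^ 2 + γ ^ 2 * σ ^ 2 := by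
    intro i
    have e := integral_norm_add_smul_sum_sq (ζ := fun _ : Unit => ζ i) (fun _ => hζ i)
      (fun _ => h0 i) (fun j k hjk => (hjk (Subsingleton.elim j k)).elim) (a i) (-γ)
    simp only [Finset.univ_unique, Finset.sum_singleton, neg_sq] at e
    rw [e]
    gcongr
    exact hσ i
  have ea' : (1 / (n : ℝ)) * ∑ i, ∫ ω, ‖a i + (-γ) • ζ i ω‖ ^ 2 ∂μ ≤
      (1 / (n : ℝ)) * ∑ i, ‖a i‖ ^ 2 + γ ^ 2 * σ ^ 2 := by
    calc _ ≤ (1 / (n : ℝ)) * ∑ i, (‖a i‖ ^ 2 + γ ^ 2 * σ ^ 2) := by gcongr with i; exact ea i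
      _ = _ := by
        rw [Finset.sum_add_distrib, Finset.sum_const, Finset.card_univ, Fintype.card_fin,
          nsmul_eq_mul]
        field_simp
  have i1 : Integrable (fun ω => κ + inner ℝ p (v ω)) μ := (integrable_const _).add iv1
  have i2 : Integrable (fun ω => κ + inner ℝ p (v ω) + L / 2 * ‖v ω‖ ^ 2) μ := i1.add iv2
  have i3 : Integrable (fun ω => β * ((1 / (n : ℝ)) * ∑ i, ‖a i + (-γ) • ζ i ω‖ ^ 2)) μ :=
    ((integrable_finsetSum _ fun i _ => ia i).const_mul _).const_mul _
  refine ⟨i2.add i3, ?_⟩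
  have e : ∫ ω, (κ + inner ℝ p (v ω) + L / 2 * ‖v ω‖ ^ 2 +
      β * ((1 / (n : ℝ)) * ∑ i, ‖a i + (-γ) • ζ i ω‖ ^ 2)) ∂μ =
      κ + -(γ * inner ℝ p g) + L / 2 * ∫ ω, ‖v ω‖ ^ 2 ∂μ +
        β * ((1 / (n : ℝ)) * ∑ i, ∫ ω, ‖a i + (-γ) • ζ i ω‖ ^ 2 ∂μ) := by
    rw [integral_add i2 i3, integral_add i1 iv2, integral_add (integrable_const _) iv1, ev1,
      integral_const, probReal_univ, one_smul, integral_const_mul, integral_const_mul,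
      integral_const_mul, integral_finsetSum _ fun i _ => ia i]
  refine e.trans_le ?_
  rw [← sub_eq_add_neg]
  gcongr

/-- The average of the local variables. -/
def mean {n N : ℕ} (x : Fin n → Vec N) : Vec N := (1 / (n : ℝ)) • ∑ i, x i

/-- The consensus error: the mean squared distance of the local variables to their average. -/
def dispersion {n N : ℕ} (x : Fin n → Vec N) : ℝ := (1 / (n : ℝ)) * ∑ i, ‖x i - mean x‖ ^ 2

/-- One iteration of D-PSGD on the ring from the local variables `x` with the samples `s`. -/
def ringStep {n N : ℕ} {Ξ : Type*} (γ : ℝ) (F : Fin n → Vec N → Ξ → ℝ) (x : Fin n → Vec N)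
    (s : Fin n → Ξ) : Fin n → Vec N :=
  fun i => ∑ j, ringWeights n i j • x j - γ • stochGrad F i (x i) (s i)

theorem dispersion_nonneg {n N : ℕ} (x : Fin n → Vec N) : 0 ≤ dispersion x := by
  unfold dispersion; positivity

theorem dispersion_le {n N : ℕ} (hn : n ≠ 0) (x : Fin n → Vec N) (z : Vec N) :
    dispersion x ≤ (1 / (n : ℝ)) * ∑ i, ‖x i - z‖ ^ 2 :=
  mul_le_mul_of_nonneg_left (sum_norm_sub_mean_sq_le hn x z) (by positivity)

theorem sum_sub_mean {n N : ℕ} (hn : n ≠ 0) (x : Fin n → Vec N) : ∑ i, (x i - mean x) = 0 := by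
  have hn' : (n : ℝ) ≠ 0 := by exact_mod_cast hn
  rw [Finset.sum_sub_distrib, Finset.sum_const, Finset.card_univ, Fintype.card_fin,
    ← Nat.cast_smul_eq_nsmul ℝ, mean, smul_smul, mul_one_div_cancel hn', one_smul, sub_self]

/-- Young's inequality, weighted so that the factor `1 + q / 2` is absorbed by a contraction `1 - q`. -/
theorem norm_sub_smul_sq_le {E : Type*} [NormedAddCommGroup E] [InnerProductSpace ℝ E] (u d : E)
    {γ q : ℝ} (hγ : 0 ≤ γ) (hq : 0 < q) :
    ‖u - γ • d‖ ^ 2 ≤ (1 + q / 2) * ‖u‖ ^ 2 + (1 + 2 / q) * γ ^ 2 * ‖d‖ ^ 2 := by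
  have h1 : ‖u - γ • d‖ ≤ ‖u‖ + γ * ‖d‖ := by
    refine (norm_sub_le _ _).trans_eq ?_
    rw [norm_smul, Real.norm_of_nonneg hγ]
  have h2 : 0 ≤ q / 2 * (‖u‖ - 2 / q * (γ * ‖d‖)) ^ 2 := by positivity
  have h3 : q / 2 * (‖u‖ - 2 / q * (γ * ‖d‖)) ^ 2 =
      q / 2 * ‖u‖ ^ 2 - 2 * ‖u‖ * (γ * ‖d‖) + 2 / q * (γ * ‖d‖) ^ 2 := by
    field_simp; ring
  calc ‖u - γ • d‖ ^ 2 ≤ (‖u‖ + γ * ‖d‖) ^ 2 := by gcongr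
    _ ≤ _ := by linarith

variable {n N : ℕ} {Ξ : Type*} [MeasurableSpace Ξ] {D : Fin n → Measure Ξ}
  {F : Fin n → Vec N → Ξ → ℝ} {L σ ς : ℝ}

namespace Assumptions

theorem sum_norm_gradient_sub_sq_le (h : Assumptions D F L σ ς) (hn : n ≠ 0)
    (x : Fin n → Vec N) :
    (1 / (n : ℝ)) * ∑ i, ‖gradient (localObj D F i) (x i) - gradient (globalObj D F) (mean x)‖ ^ 2
      ≤ 2 * L ^ 2 * dispersion x + 2 * ς ^ 2 := by
  have h1 : ∀ i, ‖gradient (localObj D F i) (x i) - gradient (globalObj D F) (mean x)‖ ^ 2 ≤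
      2 * L ^ 2 * ‖x i - mean x‖ ^ 2 +
        2 * ‖gradient (localObj D F i) (mean x) - gradient (globalObj D F) (mean x)‖ ^ 2 := by
    intro i
    have e1 := h.lipschitz i (x i) (mean x)
    have e2 := norm_sub_le_norm_sub_add_norm_sub (gradient (localObj D F i) (x i))
      (gradient (localObj D F i) (mean x)) (gradient (globalObj D F) (mean x))
    set b := ‖gradient (localObj D F i) (mean x) - gradient (globalObj D F) (mean x)‖
    calc _ ≤ (L * ‖x i - mean x‖ + b) ^ 2 := by gcongr; linarith
      _ ≤ _ := by nlinarith [sq_nonneg (L * ‖x i - mean x‖ - b)]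
  calc _ ≤ (1 / (n : ℝ)) * ∑ i, (2 * L ^ 2 * ‖x i - mean x‖ ^ 2 +
        2 * ‖gradient (localObj D F i) (mean x) - gradient (globalObj D F) (mean x)‖ ^ 2) := by
        gcongr with i; exact h1 i
    _ = 2 * L ^ 2 * dispersion x + 2 * ((1 / (n : ℝ)) * ∑ i,
        ‖gradient (localObj D F i) (mean x) - gradient (globalObj D F) (mean x)‖ ^ 2) := by
        rw [Finset.sum_add_distrib, ← Finset.mul_sum, ← Finset.mul_sum, dispersion]; ring
    _ ≤ _ := by gcongr; exact h.diversity_le (mean x)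

/-- Contraction of the consensus error by the noiseless part of an iteration. -/
theorem noiseless_dispersion_le (h : Assumptions D F L σ ς) (hn : 3 ≤ n) {γ q : ℝ}
    (hγ : 0 ≤ γ) (hq : q = 2 / (9 * (n : ℝ) ^ 2)) (hγq : 24 * γ ^ 2 * L ^ 2 ≤ q ^ 2)
    (x : Fin n → Vec N) :
    (1 / (n : ℝ)) * ∑ i, ‖(∑ j, ringWeights n i j • x j - mean x) -
        γ • (gradient (localObj D F i) (x i) - gradient (globalObj D F) (mean x))‖ ^ 2 ≤
      (1 - q / 4) * dispersion x + 6 * ς ^ 2 * γ ^ 2 / q := by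
  have hn0 : n ≠ 0 := by omega
  have : NeZero n := ⟨hn0⟩
  have hn' : (3 : ℝ) ≤ n := by exact_mod_cast hn
  have hq0 : 0 < q := by rw [hq]; positivity
  have hq1 : q ≤ 1 := by rw [hq, div_le_one (by positivity)]; nlinarith
  have hgap : (1 / (n : ℝ)) * ∑ i, ‖∑ j, ringWeights n i j • x j - mean x‖ ^ 2 ≤
      (1 - q) * dispersion x := by
    have e1 : ∀ i, ∑ j, ringWeights n i j • x j - mean x =
        ∑ j, ringWeights n i j • (x j - mean x) := fun i => by
      rw [ringWeights_sum_smul hn, ringWeights_sum_smul hn (fun j => x j - mean x)]; module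
    have e2 := sum_norm_ringWeights_sq_le hn _ (sum_sub_mean hn0 x)
    rw [← hq] at e2
    simp_rw [e1]
    calc _ ≤ (1 / (n : ℝ)) * ((1 - q) * ∑ i, ‖x i - mean x‖ ^ 2) := by gcongr
      _ = _ := by rw [dispersion]; ring
  have hgrad := h.sum_norm_gradient_sub_sq_le hn0 x
  set M := dispersion x with hM
  have hM0 : 0 ≤ M := dispersion_nonneg x
  calc _ ≤ (1 / (n : ℝ)) * ∑ i, ((1 + q / 2) * ‖∑ j, ringWeights n i j • x j - mean x‖ ^ 2 +
        (1 + 2 / q) * γ ^ 2 *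
          ‖gradient (localObj D F i) (x i) - gradient (globalObj D F) (mean x)‖ ^ 2) := by
        gcongr with i; exact norm_sub_smul_sq_le _ _ hγ hq0
    _ = (1 + q / 2) * ((1 / (n : ℝ)) * ∑ i, ‖∑ j, ringWeights n i j • x j - mean x‖ ^ 2) +
        (1 + 2 / q) * γ ^ 2 * ((1 / (n : ℝ)) * ∑ i,
          ‖gradient (localObj D F i) (x i) - gradient (globalObj D F) (mean x)‖ ^ 2) := by
        rw [Finset.sum_add_distrib, ← Finset.mul_sum, ← Finset.mul_sum]; ring
    _ ≤ (1 + q / 2) * ((1 - q) * M) + (3 / q) * γ ^ 2 * (2 * L ^ 2 * M + 2 * ς ^ 2) := by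
        have : 1 + 2 / q ≤ 3 / q := by
          rw [← sub_nonneg, show 3 / q - (1 + 2 / q) = (1 - q) / q by field_simp; ring]
          exact div_nonneg (by linarith) hq0.le
        gcongr
    _ = (1 - q / 2 - q ^ 2 / 2 + 6 * γ ^ 2 * L ^ 2 / q) * M + 6 * ς ^ 2 * γ ^ 2 / q := by
        field_simp; ring
    _ ≤ _ := by
        have : 6 * γ ^ 2 * L ^ 2 / q ≤ q / 4 := by
          rw [div_le_iff₀ hq0]; linarith
        gcongr
        nlinarith [sq_nonneg q]

/-- The error of the averaged local gradients as an approximation of `∇f` at the average. -/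
theorem norm_gradient_sub_mean_sq_le (h : Assumptions D F L σ ς) (hn : n ≠ 0)
    (x : Fin n → Vec N) :
    ‖gradient (globalObj D F) (mean x) - (1 / (n : ℝ)) • ∑ i, gradient (localObj D F i) (x i)‖ ^ 2
      ≤ L ^ 2 * dispersion x := by
  have hn' : (0 : ℝ) < n := by exact_mod_cast Nat.pos_of_ne_zero hn
  rw [h.gradient_globalObj, ← smul_sub, ← Finset.sum_sub_distrib, norm_smul, mul_pow,
    Real.norm_of_nonneg (by positivity)]
  calc _ ≤ (1 / (n : ℝ)) ^ 2 * (∑ i, L * ‖x i - mean x‖) ^ 2 := by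
        gcongr
        refine (norm_sum_le _ _).trans (Finset.sum_le_sum fun i _ => ?_)
        rw [norm_sub_rev]; exact h.lipschitz i _ _
    _ ≤ (1 / (n : ℝ)) ^ 2 * (n * ∑ i, (L * ‖x i - mean x‖) ^ 2) := by
        gcongr
        simpa using sq_sum_le_card_mul_sum_sq (s := Finset.univ) (f := fun i => L * ‖x i - mean x‖)
    _ = _ := by
        simp_rw [mul_pow, ← Finset.mul_sum]; rw [dispersion]; field_simp

theorem memLp_noise (h : Assumptions D F L σ ς) (x : Fin n → Vec N) (i : Fin n) :
    MemLp (fun s : Fin n → Ξ => stochGrad F i (x i) (s i) - gradient (localObj D F i) (x i)) 2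
      (Measure.pi D) :=
  have := h.prob
  (h.memLp_stochGrad_sub i (x i)).comp_measurePreserving (measurePreserving_eval D i)

theorem measurable_stochGrad_sub (h : Assumptions D F L σ ς) (i : Fin n) (x : Vec N) :
    Measurable fun t => stochGrad F i x t - gradient (localObj D F i) x :=
  (h.measurable_stochGrad i x).sub_const _

theorem integral_noise (h : Assumptions D F L σ ς) (hL : 0 ≤ L) (x : Fin n → Vec N) (i : Fin n) :
    ∫ s : Fin n → Ξ, (stochGrad F i (x i) (s i) - gradient (localObj D F i) (x i))
      ∂(Measure.pi D) = 0 := by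
  have := h.prob
  refine (integral_comp_eval (μ := D) (i := i)
    (h.measurable_stochGrad_sub i (x i)).aestronglyMeasurable).trans ?_
  rw [integral_sub ((h.memLp_stochGrad i (x i)).integrable one_le_two) (integrable_const _),
    h.integral_stochGrad hL, integral_const, probReal_univ, one_smul, sub_self]

theorem integral_norm_noise_sq_le (h : Assumptions D F L σ ς) (x : Fin n → Vec N) (i : Fin n) :
    ∫ s : Fin n → Ξ, ‖stochGrad F i (x i) (s i) - gradient (localObj D F i) (x i)‖ ^ 2
      ∂(Measure.pi D) ≤ σ ^ 2 := by
  have := h.prob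
  refine (integral_comp_eval (μ := D) (i := i)
    (f := fun t => ‖stochGrad F i (x i) t - gradient (localObj D F i) (x i)‖ ^ 2)
    ((h.measurable_stochGrad_sub i (x i)).norm.pow_const 2).aestronglyMeasurable).trans_le
    (h.variance_le i (x i))

theorem indepFun_noise (h : Assumptions D F L σ ς) (x : Fin n → Vec N) :
    Pairwise fun i j => IndepFun
      (fun s : Fin n → Ξ => stochGrad F i (x i) (s i) - gradient (localObj D F i) (x i))
      (fun s : Fin n → Ξ => stochGrad F j (x j) (s j) - gradient (localObj D F j) (x j))
      (Measure.pi D) :=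
  have := h.prob
  fun _ _ hij => (iIndepFun_pi (μ := D)
    (X := fun i t => stochGrad F i (x i) t - gradient (localObj D F i) (x i))
    fun i => (h.measurable_stochGrad_sub i (x i)).aemeasurable).indepFun hij

/-- As the weights are doubly stochastic, mixing does not move the average. -/
theorem mean_ringStep (hn : 3 ≤ n) (γ : ℝ) (x : Fin n → Vec N) (s : Fin n → Ξ) :
    mean (ringStep γ F x s) = mean x +
      (-(γ • (1 / (n : ℝ)) • ∑ i, gradient (localObj D F i) (x i)) + (-(γ / n)) •
        ∑ i, (stochGrad F i (x i) (s i) - gradient (localObj D F i) (x i))) := by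
  have : NeZero n := ⟨by omega⟩
  simp only [mean, ringStep, Finset.sum_sub_distrib, sum_ringWeights_sum_smul hn,
    ← Finset.smul_sum]
  module

/-- The mean minimizes the consensus error, so that the deviations may be taken from `x̄ - γ • p`;
this leaves a single noise vector in each summand. -/
theorem dispersion_ringStep_le (hn : n ≠ 0) (γ : ℝ) (x : Fin n → Vec N) (s : Fin n → Ξ)
    (p : Vec N) :
    dispersion (ringStep γ F x s) ≤ (1 / (n : ℝ)) * ∑ i,
      ‖((∑ j, ringWeights n i j • x j - mean x) - γ • (gradient (localObj D F i) (x i) - p)) +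
        (-γ) • (stochGrad F i (x i) (s i) - gradient (localObj D F i) (x i))‖ ^ 2 := by
  refine (dispersion_le hn _ (mean x - γ • p)).trans_eq ?_
  congr 2; funext i; congr 2
  simp only [ringStep]
  module

/-- The function `f(x̄) - f* + β M(x)`, with `x̄` the average of the local variables and `M(x)`
the consensus error, decreases in expectation up to the noise: on averaging over the samples of
one iteration it loses `(γ / 2) ‖∇f(x̄)‖²`. The weight `β = 2 γ L² / q` is such that the
contraction of `M` absorbs the error made by evaluating the gradients away from the average. -/
theorem lintegral_lyapunov_ringStep_le (h : Assumptions D F L σ ς) (hn : 3 ≤ n) (hL : 0 ≤ L)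
    {γ q β fs : ℝ} (hγ : 0 ≤ γ) (hq : q = 2 / (9 * (n : ℝ) ^ 2))
    (hβ : β = 2 * γ * L ^ 2 / q)
    (hγq : 24 * γ ^ 2 * L ^ 2 ≤ q ^ 2) (hγL : L * γ ≤ 1) (hfs : ∀ y, fs ≤ globalObj D F y)
    (x : Fin n → Vec N) :
    ∫⁻ s, ENNReal.ofReal (globalObj D F (mean (ringStep γ F x s)) - fs +
        β * dispersion (ringStep γ F x s)) ∂(Measure.pi D) +
      ENNReal.ofReal (γ / 2 * ‖gradient (globalObj D F) (mean x)‖ ^ 2) ≤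
    ENNReal.ofReal (globalObj D F (mean x) - fs + β * dispersion x) +
      ENNReal.ofReal (L * γ ^ 2 * σ ^ 2 / (2 * n) + β * (γ ^ 2 * σ ^ 2 + 6 * ς ^ 2 * γ ^ 2 / q)) := by
  have hn0 : n ≠ 0 := by omega
  have hn' : (0 : ℝ) < n := by exact_mod_cast Nat.pos_of_ne_zero hn0
  have hq0 : 0 < q := by rw [hq]; positivity
  have hβ0 : 0 ≤ β := by rw [hβ]; positivity
  have hprob := h.prob
  have hcons := h.noiseless_dispersion_le hn hγ hq hγq x
  have happ := h.norm_gradient_sub_mean_sq_le hn0 x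
  obtain ⟨iR, hRle⟩ := integral_quadratic_model_le hn0 (h.memLp_noise x) (h.integral_noise hL x)
    (h.indepFun_noise x) (h.integral_norm_noise_sq_le x) hL hβ0 (globalObj D F (mean x) - fs) γ
    (gradient (globalObj D F) (mean x)) ((1 / (n : ℝ)) • ∑ i, gradient (localObj D F i) (x i))
    (fun i => (∑ j, ringWeights n i j • x j - mean x) -
      γ • (gradient (localObj D F i) (x i) - gradient (globalObj D F) (mean x)))
  have hR : ∀ s, globalObj D F (mean (ringStep γ F x s)) - fs +
      β * dispersion (ringStep γ F x s) ≤
      globalObj D F (mean x) - fs + inner ℝ (gradient (globalObj D F) (mean x))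
        (-(γ • (1 / (n : ℝ)) • ∑ i, gradient (localObj D F i) (x i)) + (-(γ / n)) •
          ∑ i, (stochGrad F i (x i) (s i) - gradient (localObj D F i) (x i))) +
      L / 2 * ‖-(γ • (1 / (n : ℝ)) • ∑ i, gradient (localObj D F i) (x i)) + (-(γ / n)) •
          ∑ i, (stochGrad F i (x i) (s i) - gradient (localObj D F i) (x i))‖ ^ 2 +
      β * ((1 / (n : ℝ)) * ∑ i, ‖((∑ j, ringWeights n i j • x j - mean x) -
        γ • (gradient (localObj D F i) (x i) - gradient (globalObj D F) (mean x))) +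
        (-γ) • (stochGrad F i (x i) (s i) - gradient (localObj D F i) (x i))‖ ^ 2) := fun s => by
    have e1 := le_add_inner_add_of_lipschitz_gradient h.differentiable_globalObj
      (h.lipschitz_globalObj hn0) (mean x)
      (-(γ • (1 / (n : ℝ)) • ∑ i, gradient (localObj D F i) (x i)) + (-(γ / n)) •
        ∑ i, (stochGrad F i (x i) (s i) - gradient (localObj D F i) (x i)))
    rw [← mean_ringStep hn] at e1
    exact add_le_add (show _ ≤ globalObj D F (mean x) - fs + _ + _ by linarith) (mul_le_mul_of_nonneg_left
      (dispersion_ringStep_le hn0 γ x s (gradient (globalObj D F) (mean x))) hβ0)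
  have hR0 := fun s => le_trans (add_nonneg (sub_nonneg.2 (hfs (mean (ringStep γ F x s))))
    (mul_nonneg hβ0 (dispersion_nonneg (ringStep γ F x s)))) (hR s)
  refine (add_le_add_left (lintegral_mono fun s => ENNReal.ofReal_le_ofReal (hR s)) _).trans ?_
  rw [← ofReal_integral_eq_lintegral_ofReal iR (Filter.Eventually.of_forall hR0),
    ← ENNReal.ofReal_add]
  rotate_left
  · exact integral_nonneg hR0
  · positivity
  refine (ENNReal.ofReal_le_ofReal ?_).trans ENNReal.ofReal_add_le
  refine (add_le_add_left hRle _).trans ?_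
  generalize gradient (globalObj D F) (mean x) = p at *
  generalize (1 / (n : ℝ)) • ∑ i, gradient (localObj D F i) (x i) = g at *
  generalize (1 / (n : ℝ)) * ∑ i, ‖(∑ j, ringWeights n i j • x j - mean x) -
    γ • (gradient (localObj D F i) (x i) - p)‖ ^ 2 = A at *
  generalize dispersion x = M at *
  clear hR hR0 hRle iR
  have e4 := mul_le_mul_of_nonneg_left hcons hβ0
  -- The choice of `β`: the contraction of `M` pays for the error in the gradients.
  have e5 : β * (q / 4 * M) = γ / 2 * (L ^ 2 * M) := by rw [hβ]; field_simp; ring_nf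
  have e6 : γ / 2 * ‖p - g‖ ^ 2 ≤ γ / 2 * (L ^ 2 * M) := by gcongr
  have e8 : L * γ * (γ * ‖g‖ ^ 2) ≤ 1 * (γ * ‖g‖ ^ 2) := by gcongr
  have e9 : L / 2 * (γ ^ 2 * σ ^ 2 / n) = L * γ ^ 2 * σ ^ 2 / (2 * n) := by field_simp
  rw [norm_sub_sq_real] at e6
  rw [← e9]
  linarith

end Assumptions

end

/-! ### Independence of past and present samples, and summation -/

section

variable {n N : ℕ} {Ξ Ω : Type*} [MeasurableSpace Ξ] [MeasurableSpace Ω] {D : Fin n → Measure Ξ}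
  {F : Fin n → Vec N → Ξ → ℝ} {L σ ς : ℝ} {P : Measure Ω} {ξ : ℕ → Fin n → Ω → Ξ}

/-- The vector of all local variables after `k` iterations of D-PSGD on the ring. -/
def ringIter {Ω : Type*} (γ : ℝ) (F : Fin n → Vec N → Ξ → ℝ) (ξ : ℕ → Fin n → Ω → Ξ) (k : ℕ)
    (ω : Ω) : Fin n → Vec N :=
  fun i => iter (ringWeights n) γ F ξ k i ω

section Past

variable {Ω : Type*} {ξ : ℕ → Fin n → Ω → Ξ}

/-- The `σ`-algebra generated by the samples of the first `k` iterations. -/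
@[reducible]
def past (ξ : ℕ → Fin n → Ω → Ξ) (k : ℕ) : MeasurableSpace Ω :=
  ⨆ p ∈ {p : ℕ × Fin n | p.1 < k}, MeasurableSpace.comap (ξ p.1 p.2) inferInstance

theorem measurable_past {j k : ℕ} (hjk : j < k) (i : Fin n) : Measurable[past ξ k] (ξ j i) :=
  Measurable.mono (comap_measurable (ξ j i))
    (le_iSup₂_of_le (f := fun (p : ℕ × Fin n) (_ : p ∈ {p : ℕ × Fin n | p.1 < k}) =>
      MeasurableSpace.comap (ξ p.1 p.2) inferInstance) (j, i) hjk le_rfl) le_rfl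

theorem past_mono {j k : ℕ} (hjk : j ≤ k) : past ξ j ≤ past ξ k :=
  biSup_mono fun _ hp => lt_of_lt_of_le hp hjk

theorem Assumptions.measurable_ringStep_comp [MeasurableSpace Ω] (h : Assumptions D F L σ ς)
    (γ : ℝ) {x : Ω → Fin n → Vec N} {s : Ω → Fin n → Ξ} (hx : Measurable x) (hs : Measurable s) :
    Measurable fun ω => ringStep γ F (x ω) (s ω) := by
  have hx' : ∀ j, Measurable fun ω => x ω j := measurable_pi_iff.1 hx
  have hs' : ∀ j, Measurable fun ω => s ω j := measurable_pi_iff.1 hs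
  refine measurable_pi_lambda _ fun i => ?_
  refine Measurable.sub (Finset.measurable_sum _ fun j _ => ?_) (Measurable.const_smul ?_ γ)
  · exact (hx' j).const_smul (ringWeights n i j)
  · exact (h.measurable_uncurry_stochGrad i).comp (f := fun ω => (x ω i, s ω i))
      ((hx' i).prodMk (hs' i))

theorem Assumptions.measurable_ringIter_past (h : Assumptions D F L σ ς) (γ : ℝ) (k : ℕ) :
    Measurable[past ξ k] (ringIter γ F ξ k) := by
  induction k with
  | zero => exact @measurable_const _ _ _ (past ξ 0) 0
  | succ k ih =>
    exact @Assumptions.measurable_ringStep_comp _ _ _ _ _ _ _ _ _ _ (past ξ (k + 1)) h γ _ _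
      (ih.mono (past_mono k.le_succ) le_rfl)
      (@measurable_pi_lambda _ _ _ (past ξ (k + 1)) _ _ fun i => measurable_past k.lt_succ_self i)

end Past

namespace IsSampling

theorem past_le (hs : IsSampling D P ξ) (k : ℕ) : past ξ k ≤ ‹MeasurableSpace Ω› :=
  iSup₂_le fun p _ => (hs.law p.1 p.2).measurable.comap_le

theorem measurable_ringIter (hs : IsSampling D P ξ) (h : Assumptions D F L σ ς) (γ : ℝ) (k : ℕ) :
    Measurable (ringIter γ F ξ k) :=
  (h.measurable_ringIter_past γ k).mono (hs.past_le k) le_rfl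

theorem measurable_sample (hs : IsSampling D P ξ) (k : ℕ) : Measurable fun ω i => ξ k i ω :=
  measurable_pi_lambda _ fun i => (hs.law k i).measurable

theorem map_sample_eq_pi [IsProbabilityMeasure P] (hs : IsSampling D P ξ) (k : ℕ) :
    P.map (fun ω i => ξ k i ω) = Measure.pi D := by
  have h1 : iIndepFun (fun i => ξ k i) P :=
    hs.indep.precomp (g := fun i : Fin n => (k, i)) fun i j hij => (Prod.ext_iff.1 hij).2
  rw [(iIndepFun_iff_map_fun_eq_pi_map fun i => (hs.law k i).measurable.aemeasurable).1 h1]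
  congr 1
  funext i
  exact (hs.law k i).map_eq

/-- The samples of an iteration are independent of the current local variables. -/
theorem indepFun_ringIter_sample (hs : IsSampling D P ξ) (h : Assumptions D F L σ ς) (γ : ℝ)
    (k : ℕ) : IndepFun (ringIter γ F ξ k) (fun ω i => ξ k i ω) P := by
  have h1 := indep_iSup_of_disjoint
    (fun p : ℕ × Fin n => (hs.law p.1 p.2).measurable.comap_le) hs.indep
    (S := {p : ℕ × Fin n | p.1 < k}) (T := {p : ℕ × Fin n | p.1 = k})
    (Set.disjoint_left.2 fun p (hp : p.1 < k) (hp' : p.1 = k) => hp.ne hp')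
  refine indep_of_indep_of_le_left (indep_of_indep_of_le_right h1 ?_)
    (h.measurable_ringIter_past γ k).comap_le
  refine Measurable.comap_le ?_
  refine @measurable_pi_lambda _ _ _ (_) _ _ fun i => ?_
  exact Measurable.mono (comap_measurable (ξ k i))
    (le_iSup₂_of_le (f := fun (p : ℕ × Fin n) (_ : p ∈ {p : ℕ × Fin n | p.1 = k}) =>
      MeasurableSpace.comap (ξ p.1 p.2) inferInstance) (k, i) rfl le_rfl) le_rfl

/-- Averaging over the samples of an iteration first. -/
theorem lintegral_ringIter_succ [IsProbabilityMeasure P] (hs : IsSampling D P ξ)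
    (h : Assumptions D F L σ ς) (γ : ℝ) (k : ℕ) {φ : (Fin n → Vec N) → ENNReal}
    (hφ : Measurable φ) :
    ∫⁻ ω, φ (ringIter γ F ξ (k + 1) ω) ∂P =
      ∫⁻ ω, ∫⁻ s, φ (ringStep γ F (ringIter γ F ξ k ω) s) ∂(Measure.pi D) ∂P := by
  have hprob := h.prob
  have hX := hs.measurable_ringIter h γ k
  have hS := hs.measurable_sample k
  have hφ' := hφ.comp (h.measurable_ringStep_comp γ measurable_fst measurable_snd)
  have hmap := (indepFun_iff_map_prod_eq_prod_map_map hX.aemeasurable hS.aemeasurable).1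
    (hs.indepFun_ringIter_sample h γ k)
  rw [hs.map_sample_eq_pi] at hmap
  calc ∫⁻ ω, φ (ringIter γ F ξ (k + 1) ω) ∂P
      = ∫⁻ p, φ (ringStep γ F p.1 p.2)
          ∂(P.map fun ω => (ringIter γ F ξ k ω, fun i => ξ k i ω)) :=
        (lintegral_map hφ' (hX.prodMk hS)).symm
    _ = ∫⁻ x, ∫⁻ s, φ (ringStep γ F x s) ∂(Measure.pi D) ∂(P.map (ringIter γ F ξ k)) := by
        rw [hmap]; exact lintegral_prod _ hφ'.aemeasurable
    _ = _ := lintegral_map hφ'.lintegral_prod_right' hX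

end IsSampling

theorem continuous_mean : Continuous (mean : (Fin n → Vec N) → Vec N) := by
  unfold mean; fun_prop

theorem continuous_dispersion : Continuous (dispersion : (Fin n → Vec N) → ℝ) := by
  have := continuous_mean (n := n) (N := N)
  unfold dispersion; fun_prop

/-- Summation of the expected decrease of the Lyapunov function over the iterations. -/
theorem IsSampling.sum_integral_sq_gradient_le [IsProbabilityMeasure P] (hs : IsSampling D P ξ)
    (h : Assumptions D F L σ ς) (hn : 3 ≤ n) (hL : 0 ≤ L) {γ q β fs : ℝ} (hγ : 0 < γ)
    (hq : q = 2 / (9 * (n : ℝ) ^ 2)) (hβ : β = 2 * γ * L ^ 2 / q)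
    (hγq : 24 * γ ^ 2 * L ^ 2 ≤ q ^ 2) (hγL : L * γ ≤ 1) (hfs : ∀ y, fs ≤ globalObj D F y)
    (K : ℕ) :
    (∀ k < K, Integrable
      (fun ω => ‖gradient (globalObj D F) (mean (ringIter γ F ξ k ω))‖ ^ 2) P) ∧
    γ / 2 * ∑ k ∈ Finset.range K,
        ∫ ω, ‖gradient (globalObj D F) (mean (ringIter γ F ξ k ω))‖ ^ 2 ∂P ≤
      globalObj D F 0 - fs +
        K * (L * γ ^ 2 * σ ^ 2 / (2 * n) + β * (γ ^ 2 * σ ^ 2 + 6 * ς ^ 2 * γ ^ 2 / q)) := by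
  have hq0 : 0 < q := by
    have : (0 : ℝ) < n := by exact_mod_cast (by omega : 0 < n)
    rw [hq]; positivity
  have hβ0 : 0 ≤ β := by rw [hβ]; positivity
  set c := L * γ ^ 2 * σ ^ 2 / (2 * n) + β * (γ ^ 2 * σ ^ 2 + 6 * ς ^ 2 * γ ^ 2 / q) with hc
  have hc0 : 0 ≤ c := by positivity
  let V : (Fin n → Vec N) → ENNReal := fun x =>
    ENNReal.ofReal (globalObj D F (mean x) - fs + β * dispersion x)
  have hV : Measurable V := by
    have h1 := h.differentiable_globalObj.continuous.comp (continuous_mean (n := n) (N := N))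
    exact ((h1.sub continuous_const).add
      (continuous_const.mul continuous_dispersion)).measurable.ennreal_ofReal
  let G : ℕ → Ω → ℝ := fun k ω =>
    γ / 2 * ‖gradient (globalObj D F) (mean (ringIter γ F ξ k ω))‖ ^ 2
  have hG0 : ∀ k ω, 0 ≤ G k ω := fun k ω => by positivity
  have hGm : ∀ k, Measurable (G k) := fun k =>
    ((((h.continuous_gradient_globalObj.comp continuous_mean).measurable.comp
      (hs.measurable_ringIter h γ k)).norm.pow_const 2).const_mul _)
  have hstep : ∀ k, ∫⁻ ω, V (ringIter γ F ξ (k + 1) ω) ∂P + ∫⁻ ω, ENNReal.ofReal (G k ω) ∂P ≤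
      ∫⁻ ω, V (ringIter γ F ξ k ω) ∂P + ENNReal.ofReal c := fun k => by
    rw [hs.lintegral_ringIter_succ h γ k hV, ← lintegral_add_right _ (hGm k).ennreal_ofReal]
    refine (lintegral_mono fun ω => h.lintegral_lyapunov_ringStep_le hn hL hγ.le hq hβ hγq hγL hfs
      (ringIter γ F ξ k ω)).trans_eq ?_
    rw [lintegral_add_right _ measurable_const, lintegral_const, measure_univ, mul_one]
  have hsum : ∀ K : ℕ, ∫⁻ ω, V (ringIter γ F ξ K ω) ∂P +
      ∑ k ∈ Finset.range K, ∫⁻ ω, ENNReal.ofReal (G k ω) ∂P ≤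
      ENNReal.ofReal (globalObj D F 0 - fs + K * c) := by
    intro K
    induction K with
    | zero =>
      have e : ∀ ω, V (ringIter γ F ξ 0 ω) = ENNReal.ofReal (globalObj D F 0 - fs) := fun ω => by
        have e1 : ringIter γ F ξ 0 ω = 0 := rfl
        simp [V, e1, mean, dispersion]
      simp [e]
    | succ K ih =>
      rw [Finset.sum_range_succ]
      calc _ = ∫⁻ ω, V (ringIter γ F ξ (K + 1) ω) ∂P + ∫⁻ ω, ENNReal.ofReal (G K ω) ∂P +
            ∑ k ∈ Finset.range K, ∫⁻ ω, ENNReal.ofReal (G k ω) ∂P := by ring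
        _ ≤ ∫⁻ ω, V (ringIter γ F ξ K ω) ∂P + ENNReal.ofReal c +
            ∑ k ∈ Finset.range K, ∫⁻ ω, ENNReal.ofReal (G k ω) ∂P :=
            add_le_add (hstep K) le_rfl
        _ ≤ ENNReal.ofReal (globalObj D F 0 - fs + K * c) + ENNReal.ofReal c := by
            rw [add_right_comm]; gcongr
        _ = _ := by
            rw [← ENNReal.ofReal_add (add_nonneg (sub_nonneg.2 (hfs 0)) (by positivity)) hc0]
            push_cast; congr 1; ring
  have hsumG := le_add_self.trans (hsum K)
  have hGi : ∀ k < K, Integrable (G k) P := fun k hk =>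
    (lintegral_ofReal_ne_top_iff_integrable (hGm k).aestronglyMeasurable
      (Filter.Eventually.of_forall (hG0 k))).1
      (((Finset.single_le_sum (fun _ _ => zero_le) (Finset.mem_range.2 hk)).trans
        hsumG).trans_lt ENNReal.ofReal_lt_top).ne
  have hγ2 : γ / 2 ≠ 0 := by positivity
  refine ⟨fun k hk => (integrable_const_mul_iff (isUnit_iff_ne_zero.2 hγ2) _).1 (hGi k hk), ?_⟩
  rw [← ENNReal.ofReal_le_ofReal_iff (add_nonneg (sub_nonneg.2 (hfs 0)) (by positivity)),
    Finset.mul_sum, ENNReal.ofReal_sum_of_nonneg fun k _ => by positivity]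
  refine le_trans (Finset.sum_le_sum fun k hk => ?_) hsumG
  rw [← integral_const_mul, ofReal_integral_eq_lintegral_ofReal (hGi k (Finset.mem_range.1 hk))
    (Filter.Eventually.of_forall (hG0 k))]

end

/-! ### Evaluation at the step length -/

section

/-- The square root in the step length in terms of the one in the rate. -/
theorem sqrt_div_eq {K n : ℝ} (hn : 0 < n) : √(K / n) = √(K * n) / n := by
  rw [show K / n = K * n / n ^ 2 by field_simp, Real.sqrt_div' _ (sq_nonneg n),
    Real.sqrt_sq hn.le]

/-- Evaluation of the summed descent inequality at the step length `γ = 1 / (2 L + σ w / n)`,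
where `w = √(K n)`. -/
theorem div_le_of_summed_descent {L σ ς Δ n K w γ q S : ℝ} (hL : 0 ≤ L) (hσ : 0 < σ)
    (hΔ : 0 ≤ Δ) (hn : 0 < n) (hK : 0 < K) (hw : 0 < w) (hwK : w ^ 2 = K * n)
    (hγ : γ = 1 / (2 * L + σ * (w / n))) (hq : q = 2 / (9 * n ^ 2))
    (hH : 324 * L ^ 2 * n ^ 7 * (σ ^ 2 + 27 * n ^ 2 * ς ^ 2) ^ 2 ≤ σ ^ 6 * K)
    (hS : γ / 2 * S ≤ Δ + K * (L * γ ^ 2 * σ ^ 2 / (2 * n) +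
      2 * γ * L ^ 2 / q * (γ ^ 2 * σ ^ 2 + 6 * ς ^ 2 * γ ^ 2 / q))) :
    S / K ≤ 8 * Δ * L / K + (8 * Δ + 4 * L) * σ / w := by
  have hd : 0 < 2 * L + σ * (w / n) := by positivity
  have hγ0 : 0 < γ := by rw [hγ]; positivity
  have hγw : γ * (σ * w) ≤ n := by
    rw [hγ, one_div, inv_mul_le_iff₀ hd]
    have : (2 * L + σ * (w / n)) * n = 2 * L * n + σ * w := by field_simp
    rw [this]; have : 0 ≤ 2 * L * n := by positivity
    linarith
  set X := σ ^ 2 + 27 * n ^ 2 * ς ^ 2 with hX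
  have hX0 : 0 < X := by positivity
  have h1 : S / K ≤ 2 * Δ * (1 / γ) / K + L * γ * σ ^ 2 / n + 18 * n ^ 2 * L ^ 2 * γ ^ 2 * X := by
    have e : Δ + K * (L * γ ^ 2 * σ ^ 2 / (2 * n) +
        2 * γ * L ^ 2 / q * (γ ^ 2 * σ ^ 2 + 6 * ς ^ 2 * γ ^ 2 / q)) =
        γ / 2 * (K * (2 * Δ * (1 / γ) / K + L * γ * σ ^ 2 / n +
          18 * n ^ 2 * L ^ 2 * γ ^ 2 * X)) := by
      rw [hq, hX]; field_simp; ring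
    rw [e] at hS
    rw [div_le_iff₀ hK, mul_comm _ K]
    exact le_of_mul_le_mul_left hS (by positivity)
  have h2 : 2 * Δ * (1 / γ) / K = 4 * Δ * L / K + 2 * Δ * σ / w := by
    have hK' : K = w ^ 2 / n := by rw [hwK]; field_simp
    rw [hγ, one_div_one_div, hK']; field_simp; ring
  have h3 : L * γ * σ ^ 2 / n ≤ L * σ / w := by
    rw [div_le_div_iff₀ hn hw]
    calc L * γ * σ ^ 2 * w = L * σ * (γ * (σ * w)) := by ring
      _ ≤ L * σ * n := by gcongr
  have h4 : 18 * n ^ 2 * L ^ 2 * γ ^ 2 * X ≤ L * σ / w := by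
    have h5 : 18 * n ^ 3 * L * X * w ≤ σ ^ 3 * K := by
      refine (pow_le_pow_iff_left₀ (by positivity) (by positivity) two_ne_zero).1 ?_
      calc (18 * n ^ 3 * L * X * w) ^ 2 = 324 * L ^ 2 * n ^ 6 * X ^ 2 * w ^ 2 := by ring
        _ = (324 * L ^ 2 * n ^ 7 * X ^ 2) * K := by rw [hwK]; ring
        _ ≤ (σ ^ 6 * K) * K := by gcongr
        _ = _ := by ring
    have h6 : (γ * (σ * w)) ^ 2 ≤ n ^ 2 := by gcongr
    rw [le_div_iff₀ hw]
    have h7 : γ ^ 2 * (σ ^ 2 * K) ≤ n := by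
      have : (γ * (σ * w)) ^ 2 = γ ^ 2 * (σ ^ 2 * K) * n := by rw [mul_pow, mul_pow, hwK]; ring
      rw [this, sq n] at h6
      exact le_of_mul_le_mul_right h6 hn
    have hσK : 0 < σ ^ 2 * K := by positivity
    refine le_of_mul_le_mul_right ?_ hσK
    calc 18 * n ^ 2 * L ^ 2 * γ ^ 2 * X * w * (σ ^ 2 * K)
        = 18 * n ^ 2 * L ^ 2 * X * w * (γ ^ 2 * (σ ^ 2 * K)) := by ring
      _ ≤ 18 * n ^ 2 * L ^ 2 * X * w * n := by gcongr
      _ = L * (18 * n ^ 3 * L * X * w) := by ring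
      _ ≤ L * (σ ^ 3 * K) := by gcongr
      _ = _ := by ring
  have h8 : 4 * Δ * L / K ≤ 8 * Δ * L / K := by gcongr; norm_num
  have h9 : 2 * Δ * σ / w + L * σ / w + L * σ / w ≤ (8 * Δ + 4 * L) * σ / w := by
    rw [← add_div, ← add_div]
    gcongr
    nlinarith [mul_nonneg hΔ hσ.le, mul_nonneg hL hσ.le]
  linarith

/-- Smallness of `n` relative to `K` in the form in which it is used. -/
theorem size_conditions {L σ ς A n K : ℝ} (hσ : 0 < σ) (hn : 1 ≤ n)
    (hA : A = 486 * L ^ 2 + 324 * L ^ 2 * (σ ^ 2 + 27 * ς ^ 2) ^ 2 / σ ^ 4)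
    (hK : (ς = 0 ∧ A * n ^ 9 ≤ σ ^ 2 * K) ∨ A * n ^ 13 ≤ σ ^ 2 * K) :
    486 * L ^ 2 * n ^ 5 ≤ σ ^ 2 * K ∧
      324 * L ^ 2 * n ^ 7 * (σ ^ 2 + 27 * n ^ 2 * ς ^ 2) ^ 2 ≤ σ ^ 6 * K := by
  have hA1 : 486 * L ^ 2 ≤ A := by
    rw [hA]; exact le_add_of_nonneg_right (by positivity)
  have hA2 : 324 * L ^ 2 * (σ ^ 2 + 27 * ς ^ 2) ^ 2 ≤ A * σ ^ 4 := by
    rw [← div_le_iff₀ (by positivity), hA]; exact le_add_of_nonneg_left (by positivity)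
  have hA0 : 0 ≤ A := le_trans (by positivity) hA1
  rcases hK with ⟨h0, hK⟩ | hK
  · constructor
    · calc 486 * L ^ 2 * n ^ 5 ≤ A * n ^ 9 := by gcongr; norm_num
        _ ≤ _ := hK
    · subst h0
      calc 324 * L ^ 2 * n ^ 7 * (σ ^ 2 + 27 * n ^ 2 * 0 ^ 2) ^ 2
          = (324 * L ^ 2 * (σ ^ 2 + 27 * 0 ^ 2) ^ 2) * n ^ 7 := by ring
        _ ≤ (A * σ ^ 4) * n ^ 9 := by gcongr; norm_num
        _ = (A * n ^ 9) * σ ^ 4 := by ring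
        _ ≤ (σ ^ 2 * K) * σ ^ 4 := by gcongr
        _ = _ := by ring
  · constructor
    · calc 486 * L ^ 2 * n ^ 5 ≤ A * n ^ 13 := by gcongr; norm_num
        _ ≤ _ := hK
    · have hn2 : 1 ≤ n ^ 2 := one_le_pow₀ hn
      calc 324 * L ^ 2 * n ^ 7 * (σ ^ 2 + 27 * n ^ 2 * ς ^ 2) ^ 2
          ≤ 324 * L ^ 2 * n ^ 7 * (n ^ 2 * (σ ^ 2 + 27 * ς ^ 2)) ^ 2 := by
            gcongr
            nlinarith [mul_le_mul_of_nonneg_right hn2 (sq_nonneg σ)]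
        _ = (324 * L ^ 2 * (σ ^ 2 + 27 * ς ^ 2) ^ 2) * n ^ 11 := by ring
        _ ≤ (A * σ ^ 4) * n ^ 13 := by gcongr; norm_num
        _ = (A * n ^ 13) * σ ^ 4 := by ring
        _ ≤ (σ ^ 2 * K) * σ ^ 4 := by gcongr
        _ = _ := by ring

/-- The hypothesis `n ≤ c K ^ (1 / p)` without roots; `c ≤ 1` allows replacing `c ^ p` by `c`. -/
theorem pow_le_of_le_mul_rpow {n K c : ℝ} {p : ℕ} (hp : p ≠ 0) (hn : 0 ≤ n) (hK : 0 ≤ K)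
    (hc0 : 0 ≤ c) (hc1 : c ≤ 1) (h : n ≤ c * K ^ (1 / p : ℝ)) : n ^ p ≤ c * K := by
  calc n ^ p ≤ (c * K ^ (1 / p : ℝ)) ^ p := by gcongr
    _ = c ^ p * K := by rw [mul_pow, one_div, Real.rpow_inv_natCast_pow hK hp]
    _ ≤ c * K := by gcongr; exact pow_le_of_le_one hc0 hc1 hp

end

end DPSGD

end

theorem theorem3 (L σ ς Δ : ℝ) (hL : 0 ≤ L) (hσ : 0 < σ) (hς : 0 ≤ ς) (hΔ : 0 ≤ Δ) :
    ∃ c : ℝ, 0 < c ∧ ∃ C : ℝ, ∀ (n K N : ℕ), 3 ≤ n → 1 ≤ K →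
      ((ς = 0 ∧ (n : ℝ) ≤ c * (K : ℝ) ^ (1 / 9 : ℝ)) ∨
        (0 < ς ∧ (n : ℝ) ≤ c * (K : ℝ) ^ (1 / 13 : ℝ))) →
      ∀ (Ξ Ω : Type*) [MeasurableSpace Ξ] [MeasurableSpace Ω]
        (P : Measure Ω) [IsProbabilityMeasure P]
        (D : Fin n → Measure Ξ) (F : Fin n → DPSGD.Vec N → Ξ → ℝ) (ξ : ℕ → Fin n → Ω → Ξ),
        DPSGD.Assumptions D F L σ ς →
        BddBelow (Set.range (DPSGD.globalObj D F)) →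
        DPSGD.globalObj D F 0 - (⨅ x, DPSGD.globalObj D F x) = Δ →
        DPSGD.IsSampling D P ξ →
        (∀ k < K, Integrable (fun ω => ‖gradient (DPSGD.globalObj D F)
          (DPSGD.avgIter (DPSGD.ringWeights n) (DPSGD.stepLength L σ n K) F ξ k ω)‖ ^ 2) P) ∧
        DPSGD.avgSqGrad D F (DPSGD.ringWeights n) (DPSGD.stepLength L σ n K) P ξ K
          ≤ 8 * Δ * L / K + (8 * Δ + 4 * L) * σ / √((K : ℝ) * n) ∧
        DPSGD.avgSqGrad D F (DPSGD.ringWeights n) (DPSGD.stepLength L σ n K) P ξ K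
          ≤ C / √((K : ℝ) * n) := by
  set A := 486 * L ^ 2 + 324 * L ^ 2 * (σ ^ 2 + 27 * ς ^ 2) ^ 2 / σ ^ 4 with hA
  have hA0 : 0 ≤ A := by positivity
  have hσA : 0 < σ ^ 2 + A := by positivity
  -- The choice of `c` makes `c ≤ 1` and `A c ≤ σ²`.
  set c := σ ^ 2 / (σ ^ 2 + A) with hc
  have hc0 : 0 < c := by positivity
  have hc1 : c ≤ 1 := by rw [hc, div_le_one hσA]; linarith
  have hcA : A * c ≤ σ ^ 2 := by
    rw [hc, mul_div_assoc', div_le_iff₀ hσA]; nlinarith [sq_nonneg (σ ^ 2)]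
  refine ⟨c, hc0, 8 * Δ * L + (8 * Δ + 4 * L) * σ, ?_⟩
  intro n K N hn hK hnK Ξ Ω _ _ P _ D F ξ h hbdd hΔeq hs
  have hn1 : (1 : ℝ) ≤ n := by exact_mod_cast (by omega : 1 ≤ n)
  have hn0 : (0 : ℝ) < n := by linarith
  have hK1 : (1 : ℝ) ≤ K := by exact_mod_cast hK
  have hK0 : (0 : ℝ) < K := by linarith
  have hpow : (ς = 0 ∧ (n : ℝ) ^ 9 ≤ c * K) ∨ (n : ℝ) ^ 13 ≤ c * K := by
    rcases hnK with ⟨h0, h1⟩ | ⟨_, h1⟩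
    · exact Or.inl ⟨h0, DPSGD.pow_le_of_le_mul_rpow (by norm_num) hn0.le hK0.le hc0.le hc1
        (by exact_mod_cast h1)⟩
    · exact Or.inr (DPSGD.pow_le_of_le_mul_rpow (by norm_num) hn0.le hK0.le hc0.le hc1
        (by exact_mod_cast h1))
  have hnK' : (n : ℝ) ≤ K := by
    have h1 : c * K ≤ K := mul_le_of_le_one_left hK0.le hc1
    rcases hpow with ⟨_, h2⟩ | h2
    · exact (le_self_pow₀ hn1 (by norm_num)).trans (h2.trans h1)
    · exact (le_self_pow₀ hn1 (by norm_num)).trans (h2.trans h1)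
  have hAK : ∀ t : ℝ, t ≤ c * K → A * t ≤ σ ^ 2 * K := fun t ht => by
    calc A * t ≤ A * (c * K) := by gcongr
      _ = A * c * K := by ring
      _ ≤ σ ^ 2 * K := by gcongr
  obtain ⟨hS1, hS2⟩ := DPSGD.size_conditions (L := L) (ς := ς) hσ hn1 hA
    (hpow.imp (fun h => ⟨h.1, hAK _ h.2⟩) (hAK _))
  set w := √((K : ℝ) * n) with hw
  have hw0 : 0 < w := Real.sqrt_pos.2 (by positivity)
  have hw2 : w ^ 2 = K * n := Real.sq_sqrt (by positivity)
  set γ := DPSGD.stepLength L σ n K with hγdef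
  have hγ : γ = 1 / (2 * L + σ * (w / n)) := by
    rw [hγdef, DPSGD.stepLength, DPSGD.sqrt_div_eq hn0]
  have hd : 0 < 2 * L + σ * (w / n) := by positivity
  have hγ0 : 0 < γ := by rw [hγ]; positivity
  have hγL : L * γ ≤ 1 := by
    rw [hγ, mul_one_div, div_le_one hd]
    have : 0 ≤ σ * (w / n) := by positivity
    linarith
  have hγσ : γ ^ 2 * (σ ^ 2 * K) ≤ n := by
    rw [hγ, div_pow, one_pow, one_div, inv_mul_le_iff₀ (by positivity)]
    calc σ ^ 2 * (K : ℝ) = (σ * (w / n)) ^ 2 * n := by rw [mul_pow, div_pow, hw2]; field_simp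
      _ ≤ (2 * L + σ * (w / n)) ^ 2 * n := by gcongr; linarith
  have hγq : 24 * γ ^ 2 * L ^ 2 ≤ (2 / (9 * (n : ℝ) ^ 2)) ^ 2 := by
    have hσK : 0 < σ ^ 2 * (K : ℝ) := by positivity
    rw [div_pow, le_div_iff₀ (by positivity)]
    refine le_of_mul_le_mul_right ?_ hσK
    calc 24 * γ ^ 2 * L ^ 2 * (9 * (n : ℝ) ^ 2) ^ 2 * (σ ^ 2 * K)
        = 4 * (486 * L ^ 2 * n ^ 4 * (γ ^ 2 * (σ ^ 2 * K))) := by ring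
      _ ≤ 4 * (486 * L ^ 2 * n ^ 4 * n) := by gcongr
      _ = 4 * (486 * L ^ 2 * n ^ 5) := by ring
      _ ≤ 4 * (σ ^ 2 * K) := by gcongr
      _ = _ := by ring
  obtain ⟨hint, hsum⟩ := hs.sum_integral_sq_gradient_le h hn hL hγ0 rfl rfl hγq hγL
    (fun y => ciInf_le hbdd y) K
  rw [hΔeq] at hsum
  have hmain : DPSGD.avgSqGrad D F (DPSGD.ringWeights n) γ P ξ K
      ≤ 8 * Δ * L / K + (8 * Δ + 4 * L) * σ / w :=
    DPSGD.div_le_of_summed_descent hL hσ hΔ hn0 hK0 hw0 hw2 hγ rfl hS2 hsum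
  refine ⟨hint, hmain, hmain.trans ?_⟩
  have hwK : w ≤ K := by
    refine Real.sqrt_le_iff.2 ⟨hK0.le, ?_⟩
    rw [sq]; gcongr
  rw [add_div]
  gcongr
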